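/- **Setting.** A component type is $\mathcal C=(\mathsf P,\mathsf S,s_0,\Delta)$ with finite sets $\mathsf P$ of ports and $\mathsf S$ of states, $s_0\in\mathsf S$ and $\Delta\subseteq\mathsf S\times\mathsf P\times\mathsf S$, where no two different transitions carry the same port. A parametric system is $\mathcal S=(\mathcal C^1,\dots,\mathcal C^K,\Gamma)$, where the port sets and the state sets of the component types are pairwise disjoint and $\Gamma$ is a finite disjunction of sentences $$\exists x_1\dots\exists x_\ell\;.\;\varphi\wedge\bigwedge_{j=1}^{\ell}p_j(x_j)\wedge\bigwedge_{j=\ell+1}^{\ell+m}\forall x_j\,.\,(\psi_j\to p_j(x_j)),\qquad(1)$$ with ports $p_j$ as monadic predicate symbols and with constraints $\varphi(x_1,\dots,x_\ell)$, $\psi_j(x_1,\dots,x_\ell,x_j)$ built, without predicate symbols, from inequalities $s^a(x)\le s^b(y)$ (first-order combinations are allowed). Such IL1S formulae, over the predicate symbols $\mathsf{Pred}=\bigcup_k(\mathsf P^k\cup\mathsf S^k)$, are interpreted in $[n]=\{0,\dots,n-1\}$ with $s(x)=(x+1)\bmod n$ and the usual order. A minimal model of $\Gamma$ of size $n$ is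 an interpretation $\iota:\mathsf{Pred}\to2^{[n]}$ satisfying $\Gamma$ and minimal for pointwise inclusion. The marked Petri net $\mathcal N^n_{\mathcal S}$ has places $\bigcup_k\mathsf S^k\times[n]$, one transition $t_\iota$ for each minimal model $\iota$ of $\Gamma$ of size $n$, edges $(s,i)\to t_\iota\to(s',i)$ whenever $(s,p,s')\in\bigcup_k\Delta^k$ and $i\in\iota(p)$, and the initial marking that marks exactly the places $(s_0^k,i)$. A set $W$ of places is a trap if every transition with an input place in $W$ has an output place in $W$; it is an initially marked trap (IMT) if moreover it contains an initially marked place. The trap invariant (the set of markings that mark every IMT) is defined by the propositional formula $\mathrm{AllTrap}(\mathcal N^n_{\mathcal S})=\bigwedge_{W\text{ IMT}}\bigvee_{(s,i)\in W}s_i$ over the variables $\mathsf{pr}_i$, $\mathsf{pr}\in\mathsf{Pred}$, $i\in[n]$. The trap constraint $\Theta(\Gamma)$ is the conjunction, over the disjuncts (1) of $\Gamma$, of $$\forall x_1\dots\forall x_\ell\;.\;\varphi\wedge\Big[\bigvee_{j\le\ell}{}^\bullet p_j(x_j)\vee\bigvee_{j>\ell}\exists x_j\,.\,\psi_j\wedge{}^\bullet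 p_j(x_j)\Big]\to\bigvee_{j\le\ell}p_j^\bullet(x_j)\vee\bigvee_{j>\ell}\exists x_j\,.\,\psi_j\wedge p_j^\bullet(x_j),$$ where ${}^\bullet p(x)$, $p^\bullet(x)$ are $s(x)$, $s'(x)$ for the transition $(s,p,s')$ of port $p$, and $\bot$ if there is none. WS1S formulae are built from atoms $t_1=t_2$, $\mathsf{pr}(t)$, $X(t)$ with $\wedge,\neg,\exists x,\exists X$ and terms $s^i(x)$, $s^i(\bar 0)$, over $[n]$ with the successor that loops on $n-1$; $\le$ abbreviates its definition by second-order closure under successor. For an IL1S sentence $\phi$, first flattened so that $s$ occurs only in atoms $s(x)=y$, $\mathrm{Tr}(\phi)=\exists\xi\,.\,(\forall y\,.\,y\le\xi)\wedge\mathrm{tr}(\phi)$, where $\mathrm{tr}$ replaces $s(x)=y$ by $(x<\xi\wedge s(x)=y)\vee(x=\xi\wedge y=\bar 0)$ and commutes with everything else. Let $\mathrm{Init}(\mathcal S)=\exists x\,.\,\bigvee_k s_0^k(x)$. *Dual.* $\phi^{\sim}$ is obtained from the negation normal form of $\phi$ by exchanging $\wedge/\vee$ and $\exists/\forall$ (of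 both kinds), keeping the literals $\mathsf{pr}(t),\neg\mathsf{pr}(t)$ and negating all other literals. *Booleanization.* $B_n$ maps a WS1S sentence to a propositional formula over the variables $\mathsf{pr}_i$: $B_n(s^i(\bar0)=s^j(\bar0))$ is the truth value of $i=j\vee(i\ge n-1\wedge j\ge n-1)$, $B_n(\mathsf{pr}(s^i(\bar 0)))=\mathsf{pr}_{\min(i,n-1)}$, $B_n$ commutes with $\wedge,\neg$, $B_n(\exists x.\phi)=\bigvee_{i\in[n]}B_n(\phi[s^i(\bar0)/x])$, and $B_n(\exists X.\phi)=\bigvee_{S\subseteq[n]}B_n(\phi[S/X])$ with $X(t)[S/X]=\bigvee_{i\in S}t=s^i(\bar 0)$. *Positivation.* An automaton of a WS1S sentence $\phi$ is a nondeterministic finite automaton $A=(\{s_1,\dots,s_q\},I,F,\delta)$ over $\{0,1\}^{\mathsf{Pred}}$ that accepts, for every $n>0$, exactly those words of length $n$ that encode the models $\iota:\mathsf{Pred}\to2^{[n]}$ of $\phi$. The positivation of $\phi$ obtained from $A$ is $\phi^{\oplus}_A=\exists X_1\dots X_q\,.\,\psi_{cover}\wedge\psi_I\wedge\psi^*_\delta\wedge\psi_F$,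 where $\psi_{cover}$ says that each position lies in exactly one $X_i$, $\psi_I=\bigvee_{s_i\in I}X_i(\bar0)$, $$\psi^*_\delta=\forall x\forall y\,.\,y\le x\vee\bigvee_{(s_i,\sigma,s_j)\in\delta}X_i(x)\wedge X_j(s(x))\wedge\bigwedge_{\sigma(\mathsf{pr})=1}\mathsf{pr}(x),$$ $$\psi_F=\exists x\,.\,(\forall y\,.\,y\le x)\wedge\bigvee_{(s_i,\sigma,s_j)\in\delta,\ s_j\in F}X_i(x)\wedge\bigwedge_{\sigma(\mathsf{pr})=1}\mathsf{pr}(x).$$ For a disjunct (1) and values $a\in[n]^\ell$ of $x_1,\dots,x_\ell$ satisfying $\varphi$, the interaction described by the disjunct at $a$ consists of the port instances $(p_j,a_j)$, $j\le\ell$, and $(p_j,i)$ for $j>\ell$ and all $i$ satisfying $\psi_j$. Call $\Gamma$ *irredundant at size $n$* if every interaction described by a disjunct of $\Gamma$ in $[n]$ is a union of minimal models of $\Gamma$ of size $n$. **Theorem.** Let $\mathcal S$ be a parametric component-based system with interaction formula $\Gamma$ and let $\phi=\mathrm{Init}(\mathcal S)\wedge\mathrm{Tr}(\Theta(\Gamma))$.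 Then $\phi$ has an automaton, and for every automaton $A$ of $\phi$ and every $n>0$, $$\mathrm{AllTrap}(\mathcal N^n_{\mathcal S})\ \models\ B_n\big((\phi^{\oplus}_A)^{\sim}\big),$$ and if $\Gamma$ is irredundant at size $n$, then $$\mathrm{AllTrap}(\mathcal N^n_{\mathcal S})\ \equiv\ B_n\big((\phi^{\oplus}_A)^{\sim}\big).$$ -/

import Mathlib

noncomputable section

namespace TrapInv

/-! ### Propositional formulae -/

/-- Propositional formulae over the propositional variables `V`. -/
inductive PForm (V : Type) : Type
  | var : V → PForm V
  | top : PForm V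
  | bot : PForm V
  | neg : PForm V → PForm V
  | and : PForm V → PForm V → PForm V
  | or : PForm V → PForm V → PForm V

namespace PForm

variable {V W : Type}

/-- `β ⊨ φ` for a boolean valuation `β`. -/
def Sat (β : V → Bool) : PForm V → Prop
  | var v => β v = true
  | top => True
  | bot => False
  | neg φ => ¬ Sat β φ
  | and φ ψ => Sat β φ ∧ Sat β ψ
  | or φ ψ => Sat β φ ∨ Sat β ψ

def bigAnd (l : List (PForm V)) : PForm V := l.foldr and top

def bigOr (l : List (PForm V)) : PForm V := l.foldr or bot

/-- Renaming of propositional variables. -/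
def map (f : V → W) : PForm V → PForm W
  | var v => var (f v)
  | top => top
  | bot => bot
  | neg φ => neg (map f φ)
  | and φ ψ => and (map f φ) (map f ψ)
  | or φ ψ => or (map f φ) (map f ψ)

/-- `φ ⊨ ψ`: every valuation satisfying `φ` satisfies `ψ`. -/
def Entails (φ ψ : PForm V) : Prop := ∀ β : V → Bool, φ.Sat β → ψ.Sat β

/-- Propositional equivalence. -/
def Equivalent (φ ψ : PForm V) : Prop := ∀ β : V → Bool, φ.Sat β ↔ ψ.Sat β

end PForm

/-! ### Marked Petri nets, traps, and the trap invariant -/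

/-- A marked Petri net with places `S` and transitions `T`; the edges from places to transitions
are `inp`, those from transitions to places are `out`. -/
structure MarkedPetriNet (S T : Type) where
  inp : S → T → Prop
  out : T → S → Prop
  m₀ : S → ℕ

namespace MarkedPetriNet

variable {S T : Type}

/-- `W•`, the transitions with an incoming edge from `W`. -/
def postset (N : MarkedPetriNet S T) (W : Set S) : Set T := {t | ∃ s ∈ W, N.inp s t}

/-- `•W`, the transitions with an outgoing edge to `W`. -/
def preset (N : MarkedPetriNet S T) (W : Set S) : Set T := {t | ∃ s ∈ W, N.out t s}

def IsTrap (N : MarkedPetriNet S T) (W : Set S) : Prop := N.postset W ⊆ N.preset W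

/-- Initially marked traps. -/
def IsIMT (N : MarkedPetriNet S T) (W : Set S) : Prop := N.IsTrap W ∧ ∃ s ∈ W, N.m₀ s = 1

open Classical in
/-- The formula `⋀_{W initially marked trap} ⋁_{s ∈ W} s` defining the trap invariant, the set of
markings that mark every initially marked trap. -/
def allTrap [Fintype S] (N : MarkedPetriNet S T) : PForm S :=
  PForm.bigAnd
    ((Finset.univ.filter fun W : Finset S => N.IsIMT {s | s ∈ W}).toList.map
      fun W : Finset S => PForm.bigOr (W.toList.map PForm.var))

end MarkedPetriNet

/-! ### The interaction logic IL1S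

Variables are well-scoped de Bruijn indices: a formula of `ILForm P k` has its free variables
among `k` variables, and a quantifier binds the variable `0` of its body. -/

/-- The term `succ^shift (base)`. -/
structure ITerm (k : ℕ) where
  shift : ℕ
  base : Fin k

/-- The variable `x` as a term. -/
def ITerm.var {k : ℕ} (x : Fin k) : ITerm k := ⟨0, x⟩

/-- IL1S formulae over the monadic predicate symbols `P`. -/
inductive ILForm (P : Type) : ℕ → Type
  | le {k : ℕ} : ITerm k → ITerm k → ILForm P k
  | pred {k : ℕ} : P → ITerm k → ILForm P k
  | and {k : ℕ} : ILForm P k → ILForm P k → ILForm P k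
  | not {k : ℕ} : ILForm P k → ILForm P k
  | ex {k : ℕ} : ILForm P (k + 1) → ILForm P k

/-- The successor of IL1S on `[n]`: `x ↦ (x + 1) mod n`. -/
def ilSucc {n : ℕ} (x : Fin n) : Fin n :=
  ⟨(x.val + 1) % n, Nat.mod_lt _ (Nat.lt_of_le_of_lt (Nat.zero_le _) x.isLt)⟩

def ITerm.val {k n : ℕ} (ν : Fin k → Fin n) (t : ITerm k) : Fin n := ilSucc^[t.shift] (ν t.base)

namespace ILForm

variable {P : Type}

/-- `([n], ι, ν) ⊨ φ`. -/
def Sat {n : ℕ} (ι : P → Set (Fin n)) : {k : ℕ} → (Fin k → Fin n) → ILForm P k → Prop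
  | _, ν, le t u => t.val ν ≤ u.val ν
  | _, ν, pred p t => t.val ν ∈ ι p
  | _, ν, and φ ψ => Sat ι ν φ ∧ Sat ι ν ψ
  | _, ν, not φ => ¬ Sat ι ν φ
  | _, ν, ex φ => ∃ a : Fin n, Sat ι (Fin.cons a ν) φ

def or {k : ℕ} (φ ψ : ILForm P k) : ILForm P k := not (and (not φ) (not ψ))

def imp {k : ℕ} (φ ψ : ILForm P k) : ILForm P k := or (not φ) ψ

def all {k : ℕ} (φ : ILForm P (k + 1)) : ILForm P k := not (ex (not φ))

/-- A contradiction, `∃ x, ¬ x ≤ x`. -/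
def bot {k : ℕ} : ILForm P k := ex (not (le (ITerm.var 0) (ITerm.var 0)))

def top {k : ℕ} : ILForm P k := not bot

def bigAnd {k : ℕ} (l : List (ILForm P k)) : ILForm P k := l.foldr and top

def bigOr {k : ℕ} (l : List (ILForm P k)) : ILForm P k := l.foldr or bot

/-- Existential closure. -/
def exs : {k : ℕ} → ILForm P k → ILForm P 0
  | 0, φ => φ
  | _ + 1, φ => exs (ex φ)

/-- Universal closure. -/
def alls : {k : ℕ} → ILForm P k → ILForm P 0
  | 0, φ => φ
  | _ + 1, φ => alls (all φ)

/-- A formula without predicate symbols, as a formula over `P`. -/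
def lift : {k : ℕ} → ILForm Empty k → ILForm P k
  | _, le t u => le t u
  | _, pred p _ => p.elim
  | _, and φ ψ => and (lift φ) (lift ψ)
  | _, not φ => not (lift φ)
  | _, ex φ => ex (lift φ)

/-- `ι` is a minimal model of the sentence `φ` of size `n`, with respect to pointwise inclusion of
the sets that interpret the predicate symbols. -/
def IsMinimalModel {n : ℕ} (φ : ILForm P 0) (ι : P → Set (Fin n)) : Prop :=
  Sat ι Fin.elim0 φ ∧ ∀ ι' : P → Set (Fin n), ι' ≤ ι → ι' ≠ ι → ¬ Sat ι' Fin.elim0 φ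

end ILForm

/-! ### Component-based systems -/

/-- A component type. -/
structure ComponentType where
  Port : Type
  State : Type
  [fintypePort : Fintype Port]
  [fintypeState : Fintype State]
  init : State
  Δ : Set (State × Port × State)
  unique : ∀ t ∈ Δ, ∀ t' ∈ Δ, t.2.1 = t'.2.1 → t = t'

attribute [instance] ComponentType.fintypePort ComponentType.fintypeState

/-- The disjunct
`∃ x₁ … ∃ x_ℓ, φ ∧ ⋀_j p_j(x_j) ∧ ⋀_{j'} ∀ x_{j'}, ψ_{j'} → p_{j'}(x_{j'})`
of an interaction formula. The constraints `φ` and `ψ_{j'}` contain no predicate symbol. In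
`ψ_{j'}`, the variable `0` is `x_{j'}` and the variable `i + 1` is the variable `i` of `φ`. -/
structure Interaction (Port : Type) where
  ell : ℕ
  m : ℕ
  phi : ILForm Empty ell
  port : Fin ell → Port
  psi : Fin m → ILForm Empty (ell + 1)
  bport : Fin m → Port

/-- A parametric component-based system; the interaction formula is the disjunction of
`disjuncts`. -/
structure System where
  K : ℕ
  comp : Fin K → ComponentType
  disjuncts : List (Interaction (Σ k, (comp k).Port))

namespace System

variable (𝒮 : System)

/-- The ports of all component types (a disjoint union). -/
abbrev Port : Type := Σ k, (𝒮.comp k).Port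

/-- The states of all component types (a disjoint union). -/
abbrev State : Type := Σ k, (𝒮.comp k).State

/-- The predicate symbols: port and state names. -/
abbrev Pred : Type := 𝒮.Port ⊕ 𝒮.State

/-- `s --p--> s'` is a transition of some component type. -/
def Step (s : 𝒮.State) (p : 𝒮.Port) (s' : 𝒮.State) : Prop :=
  ∃ (k : Fin 𝒮.K) (a : (𝒮.comp k).State) (q : (𝒮.comp k).Port) (b : (𝒮.comp k).State),
    (a, q, b) ∈ (𝒮.comp k).Δ ∧ s = ⟨k, a⟩ ∧ p = ⟨k, q⟩ ∧ s' = ⟨k, b⟩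

open ILForm in
/-- A disjunct as an IL1S sentence. -/
def disjunctForm (d : Interaction 𝒮.Port) : ILForm 𝒮.Pred 0 :=
  exs (and (lift d.phi) (and
    (bigAnd ((List.finRange d.ell).map fun j => pred (Sum.inl (d.port j)) (ITerm.var j)))
    (bigAnd ((List.finRange d.m).map fun j =>
      all (imp (lift (d.psi j)) (pred (Sum.inl (d.bport j)) (ITerm.var 0)))))))

/-- The interaction formula `Γ`. -/
def interactionForm : ILForm 𝒮.Pred 0 := ILForm.bigOr (𝒮.disjuncts.map 𝒮.disjunctForm)

/-- The marked Petri net `𝒩ⁿ`: its places are the pairs of a state and an index in `[n]`, its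
transitions are the minimal models of `Γ` of size `n`. -/
def net (n : ℕ) : MarkedPetriNet (𝒮.State × Fin n)
    {ι : 𝒮.Pred → Set (Fin n) // 𝒮.interactionForm.IsMinimalModel ι} where
  inp x t := ∃ p s', 𝒮.Step x.1 p s' ∧ x.2 ∈ t.1 (Sum.inl p)
  out t y := ∃ s p, 𝒮.Step s p y.1 ∧ y.2 ∈ t.1 (Sum.inl p)
  m₀ x := open Classical in if x.1.2 = (𝒮.comp x.1.1).init then 1 else 0

open Classical in
/-- The atom `•p(t)`: `s(t)` for the unique transition `s --p--> s'`, and `⊥` if there is none. -/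
def preAtom {k : ℕ} (p : 𝒮.Port) (t : ITerm k) : ILForm 𝒮.Pred k :=
  if h : ∃ s s', 𝒮.Step s p s' then ILForm.pred (Sum.inr h.choose) t else ILForm.bot

open Classical in
/-- The atom `p•(t)`: `s'(t)` for the unique transition `s --p--> s'`, and `⊥` if there is none. -/
def postAtom {k : ℕ} (p : 𝒮.Port) (t : ITerm k) : ILForm 𝒮.Pred k :=
  if h : ∃ s' s, 𝒮.Step s p s' then ILForm.pred (Sum.inr h.choose) t else ILForm.bot

open ILForm in
/-- The trap constraint of one disjunct. -/
def disjunctTrapConstraint (d : Interaction 𝒮.Port) : ILForm 𝒮.Pred 0 :=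
  alls (imp
    (and (lift d.phi) (or
      (bigOr ((List.finRange d.ell).map fun j => 𝒮.preAtom (d.port j) (ITerm.var j)))
      (bigOr ((List.finRange d.m).map fun j =>
        ex (and (lift (d.psi j)) (𝒮.preAtom (d.bport j) (ITerm.var 0)))))))
    (or
      (bigOr ((List.finRange d.ell).map fun j => 𝒮.postAtom (d.port j) (ITerm.var j)))
      (bigOr ((List.finRange d.m).map fun j =>
        ex (and (lift (d.psi j)) (𝒮.postAtom (d.bport j) (ITerm.var 0)))))))

/-- The trap constraint `Θ(Γ)`. -/
def trapConstraint : ILForm 𝒮.Pred 0 := ILForm.bigAnd (𝒮.disjuncts.map 𝒮.disjunctTrapConstraint)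

/-- The interaction that the disjunct `d` describes for the values `ν` of `x₁, …, x_ℓ`: the port
`p_j` is in it at the index `ν j`, and the port `p_{j'}` at all indices satisfying `ψ_{j'}`. -/
def described {n : ℕ} (d : Interaction 𝒮.Port) (ν : Fin d.ell → Fin n) : 𝒮.Pred → Set (Fin n)
  | Sum.inl p => {i | (∃ j, d.port j = p ∧ ν j = i) ∨
      ∃ j, d.bport j = p ∧ (d.psi j).Sat (fun e => e.elim) (Fin.cons i ν)}
  | Sum.inr _ => ∅

/-- `Γ` is irredundant at size `n`: every interaction that a disjunct of `Γ` describes is a union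
of minimal models of `Γ`, so that none of its ports is discarded when `Γ` is interpreted by its
minimal models. -/
def Irredundant (n : ℕ) : Prop :=
  ∀ d ∈ 𝒮.disjuncts, ∀ ν : Fin d.ell → Fin n, d.phi.Sat (fun e => e.elim) ν →
    ∀ p, ∀ i ∈ 𝒮.described d ν (Sum.inl p),
      ∃ ι : 𝒮.Pred → Set (Fin n), 𝒮.interactionForm.IsMinimalModel ι ∧
        ι ≤ 𝒮.described d ν ∧ i ∈ ι (Sum.inl p)

end System

/-! ### The logic WS1S on finite words -/

/-- The term `succ^shift (base)`, where `none` is the constant `0`. -/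
structure WTerm (k : ℕ) where
  shift : ℕ
  base : Option (Fin k)

namespace WTerm

variable {k : ℕ}

def var (x : Fin k) : WTerm k := ⟨0, some x⟩

def zero : WTerm k := ⟨0, none⟩

def succ (t : WTerm k) : WTerm k := ⟨t.shift + 1, t.base⟩

end WTerm

/-- WS1S formulae with free first-order variables among `k` and free set variables among `m`
ones; each kind of quantifier binds the variable `0` of its kind in its body. -/
inductive WForm (P : Type) : ℕ → ℕ → Type
  | eq {k m : ℕ} : WTerm k → WTerm k → WForm P k m
  | pred {k m : ℕ} : P → WTerm k → WForm P k m
  | mem {k m : ℕ} : Fin m → WTerm k → WForm P k m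
  | and {k m : ℕ} : WForm P k m → WForm P k m → WForm P k m
  | not {k m : ℕ} : WForm P k m → WForm P k m
  | ex {k m : ℕ} : WForm P (k + 1) m → WForm P k m
  | exS {k m : ℕ} : WForm P k (m + 1) → WForm P k m

/-- The successor of WS1S on `[n]`, which loops on the greatest element. -/
def wsSucc {n : ℕ} (x : Fin n) : Fin n :=
  ⟨min (x.val + 1) (n - 1), by have := x.isLt; omega⟩

def WTerm.val {k n : ℕ} [NeZero n] (ν : Fin k → Fin n) (t : WTerm k) : Fin n :=
  wsSucc^[t.shift] (t.base.elim 0 ν)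

namespace WForm

variable {P : Type} {k m : ℕ}

/-- `([n], ι, ν, μ) ⊨ φ`. -/
def Sat {n : ℕ} [NeZero n] (ι : P → Set (Fin n)) :
    {k m : ℕ} → (Fin k → Fin n) → (Fin m → Set (Fin n)) → WForm P k m → Prop
  | _, _, ν, _, eq t u => t.val ν = u.val ν
  | _, _, ν, _, pred p t => t.val ν ∈ ι p
  | _, _, ν, μ, mem X t => t.val ν ∈ μ X
  | _, _, ν, μ, and φ ψ => Sat ι ν μ φ ∧ Sat ι ν μ ψ
  | _, _, ν, μ, not φ => ¬ Sat ι ν μ φ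
  | _, _, ν, μ, ex φ => ∃ a : Fin n, Sat ι (Fin.cons a ν) μ φ
  | _, _, ν, μ, exS φ => ∃ A : Set (Fin n), Sat ι ν (Fin.cons A μ) φ

def or (φ ψ : WForm P k m) : WForm P k m := not (and (not φ) (not ψ))

def imp (φ ψ : WForm P k m) : WForm P k m := or (not φ) ψ

def all (φ : WForm P (k + 1) m) : WForm P k m := not (ex (not φ))

def allS (φ : WForm P k (m + 1)) : WForm P k m := not (exS (not φ))

def bot : WForm P k m := not (eq WTerm.zero WTerm.zero)

def top : WForm P k m := eq WTerm.zero WTerm.zero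

def bigAnd (l : List (WForm P k m)) : WForm P k m := l.foldr and top

def bigOr (l : List (WForm P k m)) : WForm P k m := l.foldr or bot

/-- `t ≤ u`, by the second-order transitive closure of the successor:
every set that contains `t` and is closed under successor contains `u`. -/
def le (t u : WTerm k) : WForm P k m :=
  allS (imp (and (mem 0 t)
    (all (imp (mem 0 (WTerm.var 0)) (mem 0 (WTerm.var 0).succ)))) (mem 0 u))

def lt (t u : WTerm k) : WForm P k m := and (le t u) (not (eq t u))

/-- Existential closure over the set variables. -/
def exsS : {m : ℕ} → WForm P k m → WForm P k 0
  | 0, φ => φ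
  | _ + 1, φ => exsS (exS φ)

end WForm

/-! ### The embedding of IL1S into WS1S -/

/-- Flat IL1S formulae: the successor occurs only in the atoms `succ(x) = y`. -/
inductive FlatForm (P : Type) : ℕ → Type
  | succEq {k : ℕ} : Fin k → Fin k → FlatForm P k
  | le {k : ℕ} : Fin k → Fin k → FlatForm P k
  | pred {k : ℕ} : P → Fin k → FlatForm P k
  | and {k : ℕ} : FlatForm P k → FlatForm P k → FlatForm P k
  | not {k : ℕ} : FlatForm P k → FlatForm P k
  | ex {k : ℕ} : FlatForm P (k + 1) → FlatForm P k

namespace FlatForm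

variable {P : Type}

def imp {k : ℕ} (φ ψ : FlatForm P k) : FlatForm P k := not (and (not (not φ)) (not ψ))

def all {k : ℕ} (φ : FlatForm P (k + 1)) : FlatForm P k := not (ex (not φ))

/-- `succ^i(x) = y`, as `∀ x₁, succ(x) = x₁ → ∀ x₂, succ(x₁) = x₂ → … → succ(x_{i-1}) = y`. -/
def iterEq : {k : ℕ} → (i : ℕ) → Fin k → Fin k → FlatForm P k
  | _, 0, x, y => and (le x y) (le y x)
  | _, 1, x, y => succEq x y
  | _, i + 2, x, y => all (imp (succEq x.succ 0) (iterEq (i + 1) 0 y.succ))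

/-- The translation `tr`; in the result the last free variable is `ξ`. -/
def tr : {k : ℕ} → FlatForm P k → WForm P (k + 1) 0
  | k, succEq x y =>
    WForm.or
      (WForm.and (WForm.lt (WTerm.var x.castSucc) (WTerm.var (Fin.last k)))
        (WForm.eq (WTerm.var x.castSucc).succ (WTerm.var y.castSucc)))
      (WForm.and (WForm.eq (WTerm.var x.castSucc) (WTerm.var (Fin.last k)))
        (WForm.eq (WTerm.var y.castSucc) WTerm.zero))
  | _, le x y => WForm.le (WTerm.var x.castSucc) (WTerm.var y.castSucc)
  | _, pred p x => WForm.pred p (WTerm.var x.castSucc)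
  | _, and φ ψ => WForm.and (tr φ) (tr ψ)
  | _, not φ => WForm.not (tr φ)
  | _, ex φ => WForm.ex (tr φ)

end FlatForm

namespace ILForm

variable {P : Type}

/-- Flattening: a term inside an atom is replaced by a fresh variable equal to it. -/
def flatten : {k : ℕ} → ILForm P k → FlatForm P k
  | _, le t u => FlatForm.all (FlatForm.all
      (FlatForm.imp (FlatForm.iterEq t.shift t.base.succ.succ 1)
        (FlatForm.imp (FlatForm.iterEq u.shift u.base.succ.succ 0) (FlatForm.le 1 0))))
  | _, pred p t => FlatForm.all
      (FlatForm.imp (FlatForm.iterEq t.shift t.base.succ 0) (FlatForm.pred p 0))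
  | _, and φ ψ => FlatForm.and (flatten φ) (flatten ψ)
  | _, not φ => FlatForm.not (flatten φ)
  | _, ex φ => FlatForm.ex (flatten φ)

/-- `Tr(φ) = ∃ ξ, (∀ y, y ≤ ξ) ∧ tr(φ)`, for a sentence `φ`. -/
def Tr (φ : ILForm P 0) : WForm P 0 0 :=
  WForm.ex (WForm.and (WForm.all (WForm.le (WTerm.var 0) (WTerm.var 1))) φ.flatten.tr)

end ILForm

/-! ### Dualization of WS1S formulae -/

/-- WS1S formulae in negation normal form. -/
inductive WNNF (P : Type) : ℕ → ℕ → Type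
  | eq {k m : ℕ} : WTerm k → WTerm k → WNNF P k m
  | neq {k m : ℕ} : WTerm k → WTerm k → WNNF P k m
  | pred {k m : ℕ} : P → WTerm k → WNNF P k m
  | npred {k m : ℕ} : P → WTerm k → WNNF P k m
  | mem {k m : ℕ} : Fin m → WTerm k → WNNF P k m
  | nmem {k m : ℕ} : Fin m → WTerm k → WNNF P k m
  | and {k m : ℕ} : WNNF P k m → WNNF P k m → WNNF P k m
  | or {k m : ℕ} : WNNF P k m → WNNF P k m → WNNF P k m
  | ex {k m : ℕ} : WNNF P (k + 1) m → WNNF P k m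
  | all {k m : ℕ} : WNNF P (k + 1) m → WNNF P k m
  | exS {k m : ℕ} : WNNF P k (m + 1) → WNNF P k m
  | allS {k m : ℕ} : WNNF P k (m + 1) → WNNF P k m

namespace WNNF

variable {P : Type}

/-- Dualization of formulae in negation normal form: predicate literals are kept, all other
literals are negated. -/
def dual : {k m : ℕ} → WNNF P k m → WNNF P k m
  | _, _, eq t u => neq t u
  | _, _, neq t u => eq t u
  | _, _, pred p t => pred p t
  | _, _, npred p t => npred p t
  | _, _, mem X t => nmem X t
  | _, _, nmem X t => mem X t
  | _, _, and φ ψ => or (dual φ) (dual ψ)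
  | _, _, or φ ψ => and (dual φ) (dual ψ)
  | _, _, ex φ => all (dual φ)
  | _, _, all φ => ex (dual φ)
  | _, _, exS φ => allS (dual φ)
  | _, _, allS φ => exS (dual φ)

/-- A formula in negation normal form, as a WS1S formula. -/
def toForm : {k m : ℕ} → WNNF P k m → WForm P k m
  | _, _, eq t u => WForm.eq t u
  | _, _, neq t u => WForm.not (WForm.eq t u)
  | _, _, pred p t => WForm.pred p t
  | _, _, npred p t => WForm.not (WForm.pred p t)
  | _, _, mem X t => WForm.mem X t
  | _, _, nmem X t => WForm.not (WForm.mem X t)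
  | _, _, and φ ψ => WForm.and (toForm φ) (toForm ψ)
  | _, _, or φ ψ => WForm.or (toForm φ) (toForm ψ)
  | _, _, ex φ => WForm.ex (toForm φ)
  | _, _, all φ => WForm.all (toForm φ)
  | _, _, exS φ => WForm.exS (toForm φ)
  | _, _, allS φ => WForm.allS (toForm φ)

end WNNF

namespace WForm

variable {P : Type}

/-- The negation normal form of `φ` (for `true`) or of `¬φ` (for `false`). -/
def nnf : {k m : ℕ} → Bool → WForm P k m → WNNF P k m
  | _, _, true, eq t u => WNNF.eq t u
  | _, _, false, eq t u => WNNF.neq t u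
  | _, _, true, pred p t => WNNF.pred p t
  | _, _, false, pred p t => WNNF.npred p t
  | _, _, true, mem X t => WNNF.mem X t
  | _, _, false, mem X t => WNNF.nmem X t
  | _, _, true, and φ ψ => WNNF.and (nnf true φ) (nnf true ψ)
  | _, _, false, and φ ψ => WNNF.or (nnf false φ) (nnf false ψ)
  | _, _, true, not φ => nnf false φ
  | _, _, false, not φ => nnf true φ
  | _, _, true, ex φ => WNNF.ex (nnf true φ)
  | _, _, false, ex φ => WNNF.all (nnf false φ)
  | _, _, true, exS φ => WNNF.exS (nnf true φ)
  | _, _, false, exS φ => WNNF.allS (nnf false φ)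

/-- The dual of a WS1S formula. -/
def dual {k m : ℕ} (φ : WForm P k m) : WForm P k m := (nnf true φ).dual.toForm

/-! ### Booleanization -/

/-- Booleanization at size `n` of `φ[e/x, E/X]`, where each first-order variable `x` is replaced
by the term `succ^(e x)(0)` and each atom `X(t)` by `⋁_{i ∈ E X} t = succ^i(0)`. -/
def boolAux (n : ℕ) [NeZero n] : {k m : ℕ} → (Fin k → ℕ) → (Fin m → Finset ℕ) →
    WForm P k m → PForm (P × Fin n)
  | _, _, e, _, eq t u => boolEq n (t.shift + t.base.elim 0 e) (u.shift + u.base.elim 0 e)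
  | _, _, e, _, pred p t => PForm.var (p, ⟨min (t.shift + t.base.elim 0 e) (n - 1), by
      have := NeZero.pos n; omega⟩)
  | _, _, e, E, mem X t =>
    PForm.bigOr ((E X).toList.map fun i => boolEq n (t.shift + t.base.elim 0 e) i)
  | _, _, e, E, and φ ψ => PForm.and (boolAux n e E φ) (boolAux n e E ψ)
  | _, _, e, E, not φ => PForm.neg (boolAux n e E φ)
  | _, _, e, E, ex φ =>
    PForm.bigOr ((List.range n).map fun i => boolAux n (Fin.cons i e) E φ)
  | _, _, e, E, exS φ =>
    PForm.bigOr ((Finset.range n).powerset.toList.map fun A => boolAux n e (Fin.cons A E) φ)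
where
  /-- The booleanization of `succ^i(0) = succ^j(0)`. -/
  boolEq {V : Type} (n i j : ℕ) : PForm V :=
    if i = j ∨ (n - 1 ≤ i ∧ n - 1 ≤ j) then PForm.top else PForm.bot

/-- The booleanization `B_n(φ)` of a WS1S sentence, over the propositional variables `pr_j`. -/
def booleanize (n : ℕ) [NeZero n] (φ : WForm P 0 0) : PForm (P × Fin n) :=
  boolAux n Fin.elim0 Fin.elim0 φ

end WForm

/-! ### Automata and positivation -/

/-- A nondeterministic finite automaton over the alphabet `{0,1}^P` with states `s_0, …, s_{q-1}`. -/
structure Automaton (P : Type) where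
  q : ℕ
  I : Finset (Fin q)
  F : Finset (Fin q)
  δ : Finset (Fin q × (P → Bool) × Fin q)

namespace Automaton

variable {P : Type}

/-- The automaton accepts the word `w` of length `n`. -/
def Accepts (A : Automaton P) {n : ℕ} (w : Fin n → P → Bool) : Prop :=
  ∃ ρ : Fin (n + 1) → Fin A.q, ρ 0 ∈ A.I ∧
    (∀ i : Fin n, (ρ i.castSucc, w i, ρ i.succ) ∈ A.δ) ∧ ρ (Fin.last n) ∈ A.F

open Classical in
/-- The word `w_S` encoding a structure `([n], ι)`. -/
def wordOf {n : ℕ} (ι : P → Set (Fin n)) : Fin n → P → Bool := fun i p => decide (i ∈ ι p)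

/-- `A` is an automaton of the sentence `φ`: it accepts exactly the (words encoding the) models of
`φ`, of all sizes. -/
def IsAutomatonOf (A : Automaton P) (φ : WForm P 0 0) : Prop :=
  ∀ (n : ℕ) [NeZero n] (ι : P → Set (Fin n)),
    φ.Sat ι Fin.elim0 Fin.elim0 ↔ A.Accepts (wordOf ι)

open WForm

/-- `ψ_cover`: each position carries exactly one of the labels `X_i`. -/
def coverForm (A : Automaton P) : WForm P 0 A.q :=
  all (and
    (bigOr ((List.finRange A.q).map fun i => mem i (WTerm.var 0)))
    (bigAnd (((List.finRange A.q ×ˢ List.finRange A.q).filter fun ij => ij.1 < ij.2).map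
      fun ij => or (not (mem ij.1 (WTerm.var 0))) (not (mem ij.2 (WTerm.var 0))))))

/-- `ψ_I`: the first position is labelled with an initial state. -/
def initForm (A : Automaton P) : WForm P 0 A.q :=
  bigOr (A.I.toList.map fun i => mem i WTerm.zero)

/-- `⋀_{σ(pr) = 1} pr(t)`, the letter `σ` being read at `t`, positively. -/
def letterForm [Fintype P] {k m : ℕ} (σ : P → Bool) (t : WTerm k) : WForm P k m :=
  bigAnd (((Finset.univ : Finset P).toList.filter fun p => σ p).map fun p => pred p t)

/-- `ψ*_δ`: at each position `x` but the last, the labels of `x` and of its successor are related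
by a transition, on a letter below the one at `x`. -/
def deltaForm [Fintype P] (A : Automaton P) : WForm P 0 A.q :=
  all (all (or (le (WTerm.var 0) (WTerm.var 1))
    (bigOr (A.δ.toList.map fun t =>
      and (mem t.1 (WTerm.var 1)) (and (mem t.2.2 (WTerm.var 1).succ)
        (letterForm t.2.1 (WTerm.var 1)))))))

/-- `ψ_F`: from the label of the last position, a transition on a letter below the last one leads
to a final state. -/
def finalForm [Fintype P] (A : Automaton P) : WForm P 0 A.q :=
  ex (and (all (le (WTerm.var 0) (WTerm.var 1)))
    (bigOr ((A.δ.toList.filter fun t => t.2.2 ∈ A.F).map fun t =>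
      and (mem t.1 (WTerm.var 0)) (letterForm t.2.1 (WTerm.var 0)))))

/-- The positive WS1S sentence
`∃ X_1 … X_q, ψ_cover ∧ ψ_I ∧ ψ*_δ ∧ ψ_F`
of the automaton; it is the positivation of a sentence `φ` when `A` is an automaton of `φ`. -/
def positivation [Fintype P] (A : Automaton P) : WForm P 0 0 :=
  exsS (and A.coverForm (and A.initForm (and A.deltaForm A.finalForm)))

end Automaton

namespace System

variable (𝒮 : System)

/-- `Init(𝒮) = ∃ x, ⋁_k s₀^k(x)`. -/
def initForm : WForm 𝒮.Pred 0 0 :=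
  WForm.ex (WForm.bigOr ((List.finRange 𝒮.K).map fun k =>
    WForm.pred (Sum.inr ⟨k, (𝒮.comp k).init⟩) (WTerm.var 0)))

/-- `Init(𝒮) ∧ Tr(Θ(Γ))`. -/
def imtForm : WForm 𝒮.Pred 0 0 := WForm.and 𝒮.initForm 𝒮.trapConstraint.Tr

/-- The propositional variables of `𝒩ⁿ`, its places `(s, i)`, are the variables `s_i`. -/
def placeVar {n : ℕ} : 𝒮.State × Fin n → 𝒮.Pred × Fin n := fun x => (Sum.inr x.1, x.2)

/-- The formula defining the trap invariant of `𝒩ⁿ`, over the variables `pr_j`. -/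
def trapInvariant (n : ℕ) : PForm (𝒮.Pred × Fin n) := (𝒮.net n).allTrap.map 𝒮.placeVar

end System

end TrapInv

end

namespace TrapInv

/-! ### Semantics of the derived connectives -/

namespace PForm

variable {V W : Type} (β : V → Bool)

/-! Both formulae say that the set of true variables meets certain sets, and these sets are the same
up to the irrelevant port symbols. A valuation `β` is an interpretation whose sets consist of the
indices at which `β` is true. Dualizing a sentence amounts to negating it and complementing the
interpretation (`WForm.sat_dual`), and booleanization only evaluates (`WForm.sat_booleanize`). The
positivation holds exactly in the interpretations that lie above some accepted model
(`Automaton.sat_positivation`). Hence the booleanized dual is true at `β` iff no model of `imtForm`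
lies inside the complement of `β`, that is, iff every model meets `β`
(`sat_booleanize_dual_positivation`). The trap invariant is true at `β` iff every initially marked
trap meets `β`. It remains to compare models with initially marked traps. A minimal model of the
interaction formula is always an interaction described by a disjunct, so the trap constraint makes
the set of places of a model a trap; this gives the entailment. Conversely, if every port instance
of a described interaction lies in a minimal model inside it, the trap condition for that minimal
model yields the trap constraint for the whole interaction; this gives the equivalence. The
existence of an automaton is Büchi's theorem, proved by closing the recognizable relations under
complement, intersection and projection. -/

theorem sat_bigAnd (l : List (PForm V)) : (bigAnd l).Sat β ↔ ∀ φ ∈ l, φ.Sat β := by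
  induction l with
  | nil => simp [bigAnd, Sat]
  | cons a l ih => simpa [bigAnd, Sat] using fun _ => ih

theorem sat_bigOr (l : List (PForm V)) : (bigOr l).Sat β ↔ ∃ φ ∈ l, φ.Sat β := by
  induction l with
  | nil => simp [bigOr, Sat]
  | cons a l ih =>
    rw [List.exists_mem_cons_iff, ← ih]
    rfl

theorem sat_map (f : V → W) (γ : W → Bool) (φ : PForm V) :
    (φ.map f).Sat γ ↔ φ.Sat (fun v => γ (f v)) := by
  induction φ with
  | var v => rfl
  | top => rfl
  | bot => rfl
  | neg φ ih => exact not_congr ih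
  | and φ ψ ihφ ihψ => exact and_congr ihφ ihψ
  | or φ ψ ihφ ihψ => exact or_congr ihφ ihψ

end PForm

theorem MarkedPetriNet.sat_allTrap {S T : Type} [Fintype S] (N : MarkedPetriNet S T)
    (β : S → Bool) : N.allTrap.Sat β ↔ ∀ W : Set S, N.IsIMT W → ∃ s ∈ W, β s = true := by
  classical
  simp only [allTrap, PForm.sat_bigAnd, PForm.sat_bigOr, List.mem_map, Finset.mem_toList,
    Finset.mem_filter, Finset.mem_univ, true_and, forall_exists_index, and_imp,
    forall_apply_eq_imp_iff₂, exists_exists_and_eq_and, PForm.Sat]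
  constructor
  · intro h W hW
    obtain ⟨s, hs, hβ⟩ := h W.toFinset (by simpa using hW)
    exact ⟨s, by simpa using hs, hβ⟩
  · intro h W hW
    exact h _ hW

namespace ILForm

variable {P : Type} {n k : ℕ} (ι : P → Set (Fin n)) (ν : Fin k → Fin n)

theorem sat_or (φ ψ : ILForm P k) : (or φ ψ).Sat ι ν ↔ φ.Sat ι ν ∨ ψ.Sat ι ν := by
  simp only [or, Sat]; tauto

theorem sat_imp (φ ψ : ILForm P k) : (imp φ ψ).Sat ι ν ↔ (φ.Sat ι ν → ψ.Sat ι ν) := by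
  simp only [imp, sat_or, Sat]; tauto

theorem sat_all (φ : ILForm P (k + 1)) :
    (all φ).Sat ι ν ↔ ∀ a, φ.Sat ι (Fin.cons a ν) := by
  simp [all, Sat]

theorem not_sat_bot : ¬ (bot : ILForm P k).Sat ι ν := by
  simp [bot, Sat]

theorem sat_bigAnd (l : List (ILForm P k)) :
    (bigAnd l).Sat ι ν ↔ ∀ φ ∈ l, φ.Sat ι ν := by
  induction l with
  | nil => simpa [bigAnd, top, Sat] using not_sat_bot ι ν
  | cons a l ih =>
    rw [List.forall_mem_cons, ← ih]
    rfl

theorem sat_bigOr (l : List (ILForm P k)) :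
    (bigOr l).Sat ι ν ↔ ∃ φ ∈ l, φ.Sat ι ν := by
  induction l with
  | nil => simpa [bigOr] using not_sat_bot ι ν
  | cons a l ih =>
    rw [List.exists_mem_cons_iff, ← ih]
    exact sat_or ι ν _ _

theorem sat_exs (φ : ILForm P k) (ν₀ : Fin 0 → Fin n) :
    (exs φ).Sat ι ν₀ ↔ ∃ ν, φ.Sat ι ν := by
  induction k with
  | zero => exact ⟨fun h => ⟨_, h⟩, fun ⟨ν, h⟩ => Subsingleton.elim ν ν₀ ▸ h⟩
  | succ k ih =>
    rw [exs, ih, Fin.exists_fin_succ_pi, exists_comm]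
    rfl

theorem sat_alls (φ : ILForm P k) (ν₀ : Fin 0 → Fin n) :
    (alls φ).Sat ι ν₀ ↔ ∀ ν, φ.Sat ι ν := by
  induction k with
  | zero => exact ⟨fun h ν => Subsingleton.elim ν₀ ν ▸ h, fun h => h _⟩
  | succ k ih =>
    rw [alls, ih, Fin.forall_fin_succ_pi, forall_comm]
    simp only [sat_all]

theorem sat_lift {k : ℕ} (φ : ILForm Empty k) (ν : Fin k → Fin n) :
    (lift φ : ILForm P k).Sat ι ν ↔ φ.Sat (fun e => e.elim) ν := by
  induction φ with
  | le t u => rfl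
  | pred p t => exact p.elim
  | and φ ψ ihφ ihψ => exact and_congr (ihφ ν) (ihψ ν)
  | not φ ih => exact not_congr (ih ν)
  | ex φ ih => exact exists_congr fun a => ih _

end ILForm

theorem ITerm.val_var {k n : ℕ} (ν : Fin k → Fin n) (x : Fin k) : (ITerm.var x).val ν = ν x := rfl

namespace WTerm

variable {k n : ℕ} [NeZero n] (ν : Fin k → Fin n)

theorem val_var (x : Fin k) : (var x).val ν = ν x := rfl

theorem val_zero : (zero : WTerm k).val ν = 0 := rfl

theorem val_succ (t : WTerm k) : t.succ.val ν = wsSucc (t.val ν) :=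
  Function.iterate_succ_apply' _ _ _

end WTerm

/-! ### Iterated successors and the definable order on `[n]` -/

/-- The successor loops on `n - 1`, so the closed term with `i` successors denotes `min i (n - 1)`.
-/
theorem WForm.sat_boolEq {V : Type} (n : ℕ) (β : V → Bool) (i j : ℕ) :
    (WForm.boolAux.boolEq n i j : PForm V).Sat β ↔ min i (n - 1) = min j (n - 1) := by
  unfold WForm.boolAux.boolEq
  split_ifs <;> simp only [PForm.Sat, true_iff, false_iff] <;> omega

theorem val_iterate_wsSucc {n : ℕ} (i : ℕ) (x : Fin n) :
    (wsSucc^[i] x).val = min (i + x.val) (n - 1) := by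
  have hx := x.isLt
  induction i with
  | zero => simp; omega
  | succ i ih =>
    rw [Function.iterate_succ_apply', wsSucc]
    simp only [ih]
    omega

theorem le_iff_forall_wsSucc_closed {n : ℕ} (a b : Fin n) :
    a ≤ b ↔ ∀ A : Set (Fin n), a ∈ A → (∀ c ∈ A, wsSucc c ∈ A) → b ∈ A := by
  constructor
  · intro hab A ha hA
    have hmem : ∀ i, wsSucc^[i] a ∈ A := by
      intro i
      induction i with
      | zero => exact ha
      | succ i ih => rw [Function.iterate_succ_apply']; exact hA _ ih
    have : wsSucc^[b.val - a.val] a = b := by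
      ext
      rw [val_iterate_wsSucc]
      have := b.isLt
      omega
    exact this ▸ hmem _
  · intro h
    -- The up-set of `a` is closed under the looping successor, so by hypothesis it contains `b`.
    refine h {c | a ≤ c} (Set.mem_ofPred_eq ▸ le_refl a) fun c hc => ?_
    have := c.isLt
    simp only [Set.mem_ofPred_eq, Fin.le_def, wsSucc] at hc ⊢
    omega

namespace WForm

variable {P : Type} {n k m : ℕ} [NeZero n] (ι : P → Set (Fin n)) (ν : Fin k → Fin n)
  (μ : Fin m → Set (Fin n))

theorem sat_or (φ ψ : WForm P k m) : (or φ ψ).Sat ι ν μ ↔ φ.Sat ι ν μ ∨ ψ.Sat ι ν μ := by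
  simp only [or, Sat]; tauto

theorem sat_imp (φ ψ : WForm P k m) : (imp φ ψ).Sat ι ν μ ↔ (φ.Sat ι ν μ → ψ.Sat ι ν μ) := by
  simp only [imp, sat_or, Sat]; tauto

theorem sat_all (φ : WForm P (k + 1) m) :
    (all φ).Sat ι ν μ ↔ ∀ a, φ.Sat ι (Fin.cons a ν) μ := by
  simp [all, Sat]

theorem sat_allS (φ : WForm P k (m + 1)) :
    (allS φ).Sat ι ν μ ↔ ∀ A, φ.Sat ι ν (Fin.cons A μ) := by
  simp [allS, Sat]

theorem sat_bigAnd (l : List (WForm P k m)) :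
    (bigAnd l).Sat ι ν μ ↔ ∀ φ ∈ l, φ.Sat ι ν μ := by
  induction l with
  | nil => simp [bigAnd, top, Sat]
  | cons a l ih =>
    rw [List.forall_mem_cons, ← ih]
    rfl

theorem sat_bigOr (l : List (WForm P k m)) :
    (bigOr l).Sat ι ν μ ↔ ∃ φ ∈ l, φ.Sat ι ν μ := by
  induction l with
  | nil => simp [bigOr, bot, Sat]
  | cons a l ih =>
    rw [List.exists_mem_cons_iff, ← ih]
    exact sat_or ι ν μ _ _

theorem sat_le (t u : WTerm k) : (le t u : WForm P k m).Sat ι ν μ ↔ t.val ν ≤ u.val ν := by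
  rw [le_iff_forall_wsSucc_closed]
  simp only [le, sat_allS, sat_imp, Sat, sat_all, WTerm.val_succ, WTerm.val_var, Fin.cons_zero,
    and_imp]

theorem sat_lt (t u : WTerm k) : (lt t u : WForm P k m).Sat ι ν μ ↔ t.val ν < u.val ν := by
  rw [lt, Sat, sat_le, Sat, Sat, lt_iff_le_and_ne]

theorem sat_exsS (φ : WForm P k m) (μ₀ : Fin 0 → Set (Fin n)) :
    (exsS φ).Sat ι ν μ₀ ↔ ∃ μ, φ.Sat ι ν μ := by
  induction m with
  | zero => exact ⟨fun h => ⟨_, h⟩, fun ⟨μ, h⟩ => Subsingleton.elim μ μ₀ ▸ h⟩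
  | succ m ih =>
    rw [exsS, ih, Fin.exists_fin_succ_pi, exists_comm]
    rfl

/-! ### Dualization and booleanization -/

/-- The polarity `b` is part of the induction because a negation disappears by flipping it. -/
theorem sat_nnf (b : Bool) {k m : ℕ} (φ : WForm P k m) (ν : Fin k → Fin n)
    (μ : Fin m → Set (Fin n)) :
    (nnf b φ).toForm.Sat ι ν μ ↔ (φ.Sat ι ν μ ↔ b = true) := by
  induction φ generalizing b with
  | eq t u => cases b <;> simp [nnf, WNNF.toForm, Sat]
  | pred p t => cases b <;> simp [nnf, WNNF.toForm, Sat]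
  | mem X t => cases b <;> simp [nnf, WNNF.toForm, Sat]
  | and φ ψ ihφ ihψ =>
    cases b <;> simp [nnf, WNNF.toForm, Sat, sat_or, ihφ, ihψ, imp_iff_not_or]
  | not φ ih => cases b <;> simp [nnf, Sat, ih]
  | ex φ ih => cases b <;> simp [nnf, WNNF.toForm, Sat, sat_all, ih]
  | exS φ ih => cases b <;> simp [nnf, WNNF.toForm, Sat, sat_allS, ih]

/-- Complementing the interpretation negates exactly the literals that dualization keeps. Every
literal is thus negated, and De Morgan's laws do the rest. -/
theorem _root_.TrapInv.WNNF.sat_dual {k m : ℕ} (φ : WNNF P k m) (ν : Fin k → Fin n)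
    (μ : Fin m → Set (Fin n)) :
    φ.dual.toForm.Sat ι ν μ ↔ ¬ φ.toForm.Sat (fun p => (ι p)ᶜ) ν μ := by
  induction φ with
  | and φ ψ ihφ ihψ => simp [WNNF.dual, WNNF.toForm, Sat, sat_or, ihφ, ihψ, imp_iff_not_or]
  | or φ ψ ihφ ihψ => simp [WNNF.dual, WNNF.toForm, Sat, sat_or, ihφ, ihψ]
  | ex φ ih => simp [WNNF.dual, WNNF.toForm, Sat, sat_all, ih]
  | all φ ih => simp [WNNF.dual, WNNF.toForm, Sat, sat_all, ih]
  | exS φ ih => simp [WNNF.dual, WNNF.toForm, Sat, sat_allS, ih]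
  | allS φ ih => simp [WNNF.dual, WNNF.toForm, Sat, sat_allS, ih]
  | _ => simp [WNNF.dual, WNNF.toForm, Sat]

theorem sat_dual (φ : WForm P k m) :
    φ.dual.Sat ι ν μ ↔ ¬ φ.Sat (fun p => (ι p)ᶜ) ν μ := by
  rw [dual, WNNF.sat_dual, sat_nnf]
  simp

/-- `e` and `E` are the numerical copies of `ν` and `μ`; this invariant survives the quantifiers
because booleanization ranges over all elements and all subsets of `[n]`. -/
theorem sat_boolAux (β : P × Fin n → Bool) {k m : ℕ} (φ : WForm P k m) (e : Fin k → ℕ)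
    (E : Fin m → Finset ℕ) (ν : Fin k → Fin n) (μ : Fin m → Set (Fin n))
    (hν : ∀ x, (ν x).val = e x) (hμ : ∀ X, Fin.val '' μ X = E X) :
    (boolAux n e E φ).Sat β ↔ φ.Sat (fun p => {i | β (p, i) = true}) ν μ := by
  have hn := NeZero.pos n
  have hval : ∀ {k : ℕ} (e : Fin k → ℕ) (ν : Fin k → Fin n) (_ : ∀ x, (ν x).val = e x)
      (t : WTerm k), min (t.shift + t.base.elim 0 e) (n - 1) = (t.val ν).val := by
    intro k e ν hν t
    rw [WTerm.val, val_iterate_wsSucc]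
    cases t.base <;> simp [hν]
  induction φ with
  | eq t u => rw [boolAux, sat_boolEq, Sat, Fin.ext_iff, hval e ν hν, hval e ν hν]
  | pred p t =>
    simp only [boolAux, PForm.Sat, Sat, hval e ν hν, Fin.eta, Set.mem_ofPred_eq]
  | mem X t =>
    simp only [boolAux, PForm.sat_bigOr, Sat, List.mem_map, Finset.mem_toList,
      exists_exists_and_eq_and, sat_boolEq, hval e ν hν]
    simp only [← Finset.mem_coe, ← hμ, Set.exists_mem_image]
    constructor
    · rintro ⟨x, hx, h⟩
      -- Truncation at `n - 1` does nothing to an element of `[n]`, so the terms have equal values.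
      rwa [Fin.ext (h.trans (by omega) : (t.val ν).val = x.val)]
    · exact fun h => ⟨_, h, by omega⟩
  | and φ ψ ihφ ihψ => exact and_congr (ihφ e E ν μ hν hμ) (ihψ e E ν μ hν hμ)
  | not φ ih => exact not_congr (ih e E ν μ hν hμ)
  | ex φ ih =>
    simp only [boolAux, PForm.sat_bigOr, Sat, List.mem_map, List.mem_range,
      exists_exists_and_eq_and]
    have key : ∀ a : Fin n, _ ↔ _ := fun a =>
      ih (Fin.cons a.val e) E (Fin.cons a ν) μ (Fin.cases rfl hν) hμ
    exact ⟨fun ⟨i, hi, h⟩ => ⟨⟨i, hi⟩, (key ⟨i, hi⟩).1 h⟩,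
      fun ⟨a, h⟩ => ⟨a, a.isLt, (key a).2 h⟩⟩
  | exS φ ih =>
    simp only [boolAux, PForm.sat_bigOr, Sat, List.mem_map, Finset.mem_toList,
      Finset.mem_powerset, exists_exists_and_eq_and]
    have key : ∀ (A : Set (Fin n)) (B : Finset ℕ), Fin.val '' A = B → (_ ↔ _) := fun A B h =>
      ih e (Fin.cons B E) ν (Fin.cons A μ) hν (Fin.cases h hμ)
    constructor
    · rintro ⟨B, hB, h⟩
      refine ⟨{x | x.val ∈ B}, (key _ B ?_).1 h⟩
      ext i
      simp only [Set.mem_image, Set.mem_ofPred_eq, Finset.mem_coe]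
      exact ⟨fun ⟨x, hx, h⟩ => h ▸ hx, fun hi => ⟨⟨i, Finset.mem_range.1 (hB hi)⟩, hi, rfl⟩⟩
    · rintro ⟨A, h⟩
      classical
      refine ⟨A.toFinset.map Fin.valEmbedding, fun i hi => ?_, (key A _ ?_).2 h⟩
      · simp only [Finset.mem_map] at hi
        obtain ⟨x, -, rfl⟩ := hi
        simp
      · simp

theorem sat_booleanize (β : P × Fin n → Bool) (φ : WForm P 0 0) :
    (φ.booleanize n).Sat β ↔ φ.Sat (fun p => {i | β (p, i) = true}) Fin.elim0 Fin.elim0 :=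
  sat_boolAux β φ _ _ _ _ (fun x => x.elim0) fun X => X.elim0

end WForm

/-! ### Correctness of the embedding of IL1S into WS1S -/

namespace FlatForm

variable {P : Type} {n k : ℕ} [NeZero n] (ι : P → Set (Fin n)) (ν : Fin k → Fin n) (ξ : Fin n)
  (μ : Fin 0 → Set (Fin n))

theorem sat_tr_not (φ : FlatForm P k) :
    (not φ).tr.Sat ι (Fin.snoc ν ξ : Fin (k + 1) → Fin n) μ ↔
      ¬ φ.tr.Sat ι (Fin.snoc ν ξ : Fin (k + 1) → Fin n) μ := Iff.rfl

theorem sat_tr_and (φ ψ : FlatForm P k) :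
    (and φ ψ).tr.Sat ι (Fin.snoc ν ξ : Fin (k + 1) → Fin n) μ ↔
      φ.tr.Sat ι (Fin.snoc ν ξ : Fin (k + 1) → Fin n) μ ∧
        ψ.tr.Sat ι (Fin.snoc ν ξ : Fin (k + 1) → Fin n) μ := Iff.rfl

theorem sat_tr_imp (φ ψ : FlatForm P k) :
    (imp φ ψ).tr.Sat ι (Fin.snoc ν ξ : Fin (k + 1) → Fin n) μ ↔
      (φ.tr.Sat ι (Fin.snoc ν ξ : Fin (k + 1) → Fin n) μ →
        ψ.tr.Sat ι (Fin.snoc ν ξ : Fin (k + 1) → Fin n) μ) := by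
  simp only [imp, sat_tr_not, sat_tr_and]
  tauto

/-- Quantified values enter at the front by `Fin.cons`, while `ξ` stays last by `Fin.snoc`; the two
operations commute. -/
theorem sat_tr_ex (φ : FlatForm P (k + 1)) :
    (ex φ).tr.Sat ι (Fin.snoc ν ξ : Fin (k + 1) → Fin n) μ ↔
      ∃ a, φ.tr.Sat ι (Fin.snoc (Fin.cons a ν : Fin (k + 1) → Fin n) ξ : Fin (k + 2) → Fin n) μ := by
  simp only [tr, WForm.Sat, Fin.cons_snoc_eq_snoc_cons]

theorem sat_tr_all (φ : FlatForm P (k + 1)) :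
    (all φ).tr.Sat ι (Fin.snoc ν ξ : Fin (k + 1) → Fin n) μ ↔
      ∀ a, φ.tr.Sat ι (Fin.snoc (Fin.cons a ν : Fin (k + 1) → Fin n) ξ : Fin (k + 2) → Fin n) μ := by
  simp only [all, sat_tr_not, sat_tr_ex, not_exists, not_not]

theorem sat_tr_le (x y : Fin k) :
    (le x y : FlatForm P k).tr.Sat ι (Fin.snoc ν ξ : Fin (k + 1) → Fin n) μ ↔ ν x ≤ ν y := by
  simp only [tr, WForm.sat_le, WTerm.val_var, Fin.snoc_castSucc]

theorem sat_tr_pred (p : P) (x : Fin k) :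
    (pred p x).tr.Sat ι (Fin.snoc ν ξ : Fin (k + 1) → Fin n) μ ↔ ν x ∈ ι p := by
  simp only [tr, WForm.Sat, WTerm.val_var, Fin.snoc_castSucc]

/-- The hypothesis forces `ξ = n - 1`, the only point where the cyclic and the looping successor can
differ; there the second disjunct prescribes the value `0`. -/
theorem sat_tr_succEq (hξ : ∀ y, y ≤ ξ) (x y : Fin k) :
    (succEq x y : FlatForm P k).tr.Sat ι (Fin.snoc ν ξ : Fin (k + 1) → Fin n) μ ↔
      ilSucc (ν x) = ν y := by
  simp only [tr, WForm.sat_or, WForm.sat_lt, WForm.Sat, WTerm.val_var, WTerm.val_succ,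
    WTerm.val_zero, Fin.snoc_castSucc, Fin.snoc_last]
  have hn := NeZero.pos n
  have hξ' : ξ.val = n - 1 := by
    have := Fin.le_def.1 (hξ ⟨n - 1, by omega⟩)
    have := ξ.isLt
    simp only at *
    omega
  have hx := (ν x).isLt
  simp only [Fin.ext_iff, Fin.lt_def, wsSucc, ilSucc, hξ', Fin.val_zero]
  by_cases h : (ν x).val = n - 1
  · have : ((ν x).val + 1) % n = 0 := by
      rw [h, Nat.sub_add_cancel hn, Nat.mod_self]
    omega
  · rw [Nat.mod_eq_of_lt (by omega)]
    omega

/-- Each universally quantified intermediate point is determined by its predecessor, so the chain of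
implications computes the iterate. -/
theorem sat_tr_iterEq (hξ : ∀ y, y ≤ ξ) (i : ℕ) {k : ℕ} (ν : Fin k → Fin n) (x y : Fin k) :
    (iterEq i x y : FlatForm P k).tr.Sat ι (Fin.snoc ν ξ : Fin (k + 1) → Fin n) μ ↔
      ilSucc^[i] (ν x) = ν y := by
  induction i generalizing k with
  | zero => simp only [iterEq, sat_tr_and, sat_tr_le, Function.iterate_zero, id, le_antisymm_iff]
  | succ i ih =>
    cases i with
    | zero => exact sat_tr_succEq ι ν ξ μ hξ x y
    | succ i =>
      simp only [iterEq, sat_tr_all, sat_tr_imp, sat_tr_succEq _ _ _ _ hξ, ih, Fin.cons_zero,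
        Fin.cons_succ, forall_eq', Function.iterate_succ_apply]

end FlatForm

namespace ILForm

variable {P : Type} {n : ℕ} [NeZero n] (ι : P → Set (Fin n))

theorem sat_flatten_tr (ξ : Fin n) (μ : Fin 0 → Set (Fin n)) (hξ : ∀ y, y ≤ ξ) {k : ℕ}
    (φ : ILForm P k) (ν : Fin k → Fin n) :
    φ.flatten.tr.Sat ι (Fin.snoc ν ξ : Fin (k + 1) → Fin n) μ ↔ φ.Sat ι ν := by
  induction φ with
  | le t u =>
    simp only [flatten, FlatForm.sat_tr_all, FlatForm.sat_tr_imp,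
      FlatForm.sat_tr_iterEq _ _ _ hξ, FlatForm.sat_tr_le, Fin.cons_succ, Fin.cons_zero,
      Fin.cons_one, Sat, ITerm.val]
    exact ⟨fun h => h _ _ rfl rfl, by rintro h a b rfl rfl; exact h⟩
  | pred p t =>
    simp only [flatten, FlatForm.sat_tr_all, FlatForm.sat_tr_imp,
      FlatForm.sat_tr_iterEq _ _ _ hξ, FlatForm.sat_tr_pred, Fin.cons_succ, Fin.cons_zero,
      Sat, ITerm.val, forall_eq']
  | and φ ψ ihφ ihψ => exact and_congr (ihφ ν) (ihψ ν)
  | not φ ih => exact not_congr (ih ν)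
  | ex φ ih => simp only [flatten, FlatForm.sat_tr_ex, Sat, ih]

theorem sat_Tr (φ : ILForm P 0) : φ.Tr.Sat ι Fin.elim0 Fin.elim0 ↔ φ.Sat ι Fin.elim0 := by
  have hn := NeZero.pos n
  simp only [Tr, WForm.Sat, WForm.sat_all, WForm.sat_le, WTerm.val_var, Fin.cons_zero,
    Fin.cons_one]
  -- With a single variable, `ξ` is both the first and the last one.
  have key : ∀ ξ : Fin n, (Fin.cons ξ Fin.elim0 : Fin 1 → Fin n) = Fin.snoc Fin.elim0 ξ :=
    fun ξ => funext fun x => by rw [Fin.fin_one_eq_zero x]; rfl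
  constructor
  · rintro ⟨ξ, hξ, h⟩
    rw [key] at h
    exact (sat_flatten_tr ι ξ _ hξ φ _).1 h
  · intro h
    have hξ : ∀ y : Fin n, y ≤ ⟨n - 1, by omega⟩ := fun y => by
      have := y.isLt
      rw [Fin.le_def]
      simp only
      omega
    refine ⟨_, hξ, ?_⟩
    rw [key]
    exact (sat_flatten_tr ι _ _ hξ φ _).2 h

end ILForm

/-! ### The positivation -/

theorem Automaton.wordOf_eq_true {P : Type} {n : ℕ} (ι : P → Set (Fin n)) (i : Fin n) (p : P) :
    wordOf ι i p = true ↔ i ∈ ι p := by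
  simp [wordOf]

namespace Automaton

variable {P : Type} {n : ℕ} [NeZero n] (A : Automaton P) (ι : P → Set (Fin n))
  (μ : Fin A.q → Set (Fin n))

theorem sat_coverForm :
    A.coverForm.Sat ι Fin.elim0 μ ↔ ∀ x, ∃! i, x ∈ μ i := by
  have hdisj : ∀ (x : Fin n) (i j : Fin A.q),
      (WForm.or (WForm.not (WForm.mem i (WTerm.var 0)))
        (WForm.not (WForm.mem j (WTerm.var 0))) : WForm P 1 A.q).Sat ι (Fin.cons x Fin.elim0) μ ↔
        (x ∈ μ i → x ∉ μ j) := fun x i j => by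
    simp only [WForm.sat_or, WForm.Sat, WTerm.val_var, Fin.cons_zero, imp_iff_not_or]
  simp only [coverForm, WForm.sat_all, WForm.Sat, WForm.sat_bigOr, WForm.sat_bigAnd,
    List.forall_mem_map]
  simp only [List.mem_map, List.mem_finRange, true_and, exists_exists_eq_and,
    List.mem_filter, List.mem_product, decide_eq_true_eq, hdisj, Prod.forall]
  refine forall_congr' fun x => ⟨?_, ?_⟩
  · rintro ⟨⟨i, hi⟩, h⟩
    refine ⟨i, hi, fun j hj => ?_⟩
    rcases lt_trichotomy i j with hij | hij | hij
    · exact absurd hj (h i j hij hi)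
    · exact hij.symm
    · exact absurd hi (h j i hij hj)
  · rintro ⟨i, hi, h⟩
    exact ⟨⟨i, hi⟩, fun a b hab ha hb => hab.ne ((h a ha).trans (h b hb).symm)⟩

theorem sat_initForm :
    A.initForm.Sat ι Fin.elim0 μ ↔ ∃ i ∈ A.I, 0 ∈ μ i := by
  simp only [initForm, WForm.sat_bigOr, List.mem_map, Finset.mem_toList,
    exists_exists_and_eq_and, WForm.Sat, WTerm.val_zero]

theorem sat_letterForm [Fintype P] {k m : ℕ} (σ : P → Bool) (t : WTerm k) (ν : Fin k → Fin n)
    (μ : Fin m → Set (Fin n)) :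
    (letterForm σ t : WForm P k m).Sat ι ν μ ↔ ∀ p, σ p = true → t.val ν ∈ ι p := by
  simp [letterForm, WForm.sat_bigAnd, WForm.Sat]

/-- The point `y` only witnesses that `x` is not the last position. -/
theorem sat_deltaForm [Fintype P] :
    A.deltaForm.Sat ι Fin.elim0 μ ↔ ∀ x y : Fin n, x < y → ∃ t ∈ A.δ,
      x ∈ μ t.1 ∧ wsSucc x ∈ μ t.2.2 ∧ ∀ p, t.2.1 p = true → x ∈ ι p := by
  simp only [deltaForm, WForm.sat_all, WForm.sat_or, WForm.sat_le, WForm.sat_bigOr,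
    List.mem_map, Finset.mem_toList, exists_exists_and_eq_and, WForm.Sat, sat_letterForm,
    WTerm.val_succ, WTerm.val_var, Fin.cons_zero, Fin.cons_one, or_iff_not_imp_left, not_le]

theorem sat_finalForm [Fintype P] :
    A.finalForm.Sat ι Fin.elim0 μ ↔ ∃ x : Fin n, (∀ y, y ≤ x) ∧ ∃ t ∈ A.δ, t.2.2 ∈ A.F ∧
      x ∈ μ t.1 ∧ ∀ p, t.2.1 p = true → x ∈ ι p := by
  simp only [finalForm, WForm.sat_all, WForm.sat_le, WForm.sat_bigOr, List.mem_filter,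
    List.mem_map, Finset.mem_toList, exists_exists_and_eq_and, WForm.Sat, sat_letterForm,
    WTerm.val_var, Fin.cons_zero, Fin.cons_one, decide_eq_true_eq]
  simp only [and_assoc]

/-- The positivation describes the upward closure of the models accepted by the automaton. -/
theorem sat_positivation [Fintype P] :
    A.positivation.Sat ι Fin.elim0 Fin.elim0 ↔ ∃ ι' ≤ ι, A.Accepts (wordOf ι') := by
  obtain ⟨N, rfl⟩ : ∃ N, n = N + 1 := Nat.exists_eq_succ_of_ne_zero (NeZero.ne n)
  simp only [positivation, WForm.sat_exsS, WForm.Sat, sat_coverForm, sat_initForm, sat_deltaForm,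
    sat_finalForm]
  constructor
  · rintro ⟨μ, hcov, ⟨i₀, hi₀, h₀⟩, hδ, x, hx, t, ht, htF, hxt, hlet⟩
    choose r hr hr' using hcov
    simp only at hr hr'
    have hxl : x = Fin.last N := le_antisymm (Fin.le_last x) (hx _)
    -- The labels `r`, followed by the target of the transition given by `finalForm`, form a run.
    -- Its letters `σ i` lie below those of `ι` because `letterForm` tests only the ones of a
    -- letter.
    have hstep : ∀ i : Fin (N + 1), ∃ σ : P → Bool, (∀ p, σ p = true → i ∈ ι p) ∧
        (r i, σ, (Fin.snoc r t.2.2 : Fin (N + 2) → Fin A.q) i.succ) ∈ A.δ := by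
      intro i
      induction i using Fin.lastCases with
      | last =>
        subst hxl
        refine ⟨t.2.1, hlet, ?_⟩
        rw [Fin.succ_last, Fin.snoc_last, ← hr' _ _ hxt]
        exact ht
      | cast i =>
        obtain ⟨u, hu, h1, h2, h3⟩ := hδ i.castSucc (Fin.last N) (Fin.castSucc_lt_last i)
        refine ⟨u.2.1, h3, ?_⟩
        have hs : wsSucc i.castSucc = i.succ := by
          ext
          simp only [wsSucc, Fin.val_castSucc, Fin.val_succ]
          omega
        rw [hs] at h2
        rw [Fin.succ_castSucc, Fin.snoc_castSucc, ← hr' _ _ h1, ← hr' _ _ h2]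
        exact hu
    choose σ hσ hσδ using hstep
    -- The smaller model is the interpretation encoded by the letters of the run.
    refine ⟨fun p => {i | σ i p = true}, fun p i hi => hσ i p hi, Fin.snoc r t.2.2, ?_, ?_, ?_⟩
    · rw [← Fin.castSucc_zero, Fin.snoc_castSucc, ← hr' _ _ h₀]
      exact hi₀
    · intro i
      rw [Fin.snoc_castSucc]
      have hw : wordOf (fun p => {i | σ i p = true}) i = σ i :=
        funext fun p => Bool.eq_iff_iff.2 (wordOf_eq_true _ _ _)
      exact hw ▸ hσδ i
    · rwa [Fin.snoc_last]
  · rintro ⟨ι', hι', ρ, h₀, hδ, hF⟩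
    have hlet : ∀ i p, wordOf ι' i p = true → i ∈ ι p := fun i p h =>
      hι' p ((wordOf_eq_true _ _ _).1 h)
    -- Each position is labelled with the state of the run before its letter is read; the state
    -- after the last letter is left to `finalForm`.
    refine ⟨fun j => {i | ρ i.castSucc = j}, fun x => ⟨_, rfl, fun j hj => hj.symm⟩,
      ⟨_, h₀, rfl⟩, fun x y hxy => ⟨_, hδ x, rfl, ?_, hlet x⟩,
      Fin.last N, Fin.le_last, _, hδ _, ?_, rfl, hlet _⟩
    · change ρ (wsSucc x).castSucc = ρ x.succ
      congr 1
      ext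
      simp only [wsSucc, Fin.val_castSucc, Fin.val_succ]
      have := y.isLt
      rw [Fin.lt_def] at hxy
      omega
    · rwa [Fin.succ_last]

end Automaton

/-! ### Automata of WS1S sentences -/

theorem NFA.mem_evalFrom_ofFn {α σ : Type} (M : NFA α σ) (s : σ) {n : ℕ} (S : Set σ)
    (w : Fin n → α) : s ∈ M.evalFrom S (List.ofFn w) ↔ ∃ ρ : Fin (n + 1) → σ, ρ 0 ∈ S ∧
      (∀ i : Fin n, ρ i.succ ∈ M.step (ρ i.castSucc) (w i)) ∧ ρ (Fin.last n) = s := by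
  induction n generalizing S with
  | zero =>
    simp only [List.ofFn_zero, NFA.evalFrom_nil]
    exact ⟨fun h => ⟨fun _ => s, h, fun i => i.elim0, rfl⟩, fun ⟨ρ, h, _, e⟩ => e ▸ h⟩
  | succ n ih =>
    rw [List.ofFn_succ, NFA.evalFrom_cons, ih]
    constructor
    · rintro ⟨ρ, h₀, h, hs⟩
      obtain ⟨t, ht, ht'⟩ := M.mem_stepSet.1 h₀
      refine ⟨Fin.cons t ρ, ht, fun i => ?_, ?_⟩
      · induction i using Fin.cases with
        | zero => exact ht'
        | succ i => exact h i
      · rwa [← Fin.succ_last, Fin.cons_succ]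
    · rintro ⟨ρ, h₀, h, hs⟩
      exact ⟨fun i => ρ i.succ, M.mem_stepSet.2 ⟨_, h₀, h 0⟩, fun i => h i.succ, hs⟩

theorem NFA.ofFn_mem_accepts {α σ : Type} (M : NFA α σ) {n : ℕ} (w : Fin n → α) :
    List.ofFn w ∈ M.accepts ↔ ∃ ρ : Fin (n + 1) → σ, ρ 0 ∈ M.start ∧
      (∀ i : Fin n, ρ i.succ ∈ M.step (ρ i.castSucc) (w i)) ∧ ρ (Fin.last n) ∈ M.accept := by
  simp only [NFA.mem_accepts, NFA.mem_evalFrom_ofFn]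
  exact ⟨fun ⟨s, hs, ρ, h₀, h, e⟩ => ⟨ρ, h₀, h, e ▸ hs⟩,
    fun ⟨ρ, h₀, h, hs⟩ => ⟨_, hs, ρ, h₀, h, rfl⟩⟩

/-! ### Closure properties and basic recognizable relations -/

open Automaton (wordOf wordOf_eq_true)

/-- A property of tuples of sets of positions is recognizable if a finite automaton accepts
exactly the words of positive length that encode the tuples with the property. -/
def Recognizable {V : Type} (R : ∀ (n : ℕ) [NeZero n], (V → Set (Fin n)) → Prop) : Prop :=
  ∃ (σ : Type) (_ : Finite σ) (M : NFA (V → Bool) σ),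
    ∀ (n : ℕ) [NeZero n] (κ : V → Set (Fin n)), List.ofFn (wordOf κ) ∈ M.accepts ↔ R n κ

namespace Recognizable

variable {V : Type}

theorem congr {R R' : ∀ (n : ℕ) [NeZero n], (V → Set (Fin n)) → Prop} (h : Recognizable R)
    (hR : ∀ (n : ℕ) [NeZero n] (κ : V → Set (Fin n)), R n κ ↔ R' n κ) : Recognizable R' := by
  obtain ⟨σ, hσ, M, hM⟩ := h
  exact ⟨σ, hσ, M, fun n _ κ => (hM n κ).trans (hR n κ)⟩

/-- Determinization by the subset construction, then complementation. -/
theorem not {R : ∀ (n : ℕ) [NeZero n], (V → Set (Fin n)) → Prop} (h : Recognizable R) :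
    Recognizable fun n _ κ => ¬ R n κ := by
  obtain ⟨σ, hσ, M, hM⟩ := h
  refine ⟨Set σ, inferInstance, M.toDFAᶜ.toNFA, fun n _ κ => ?_⟩
  rw [DFA.toNFA_correct, DFA.accepts_compl, NFA.toDFA_correct]
  exact not_congr (hM n κ)

theorem and {R R' : ∀ (n : ℕ) [NeZero n], (V → Set (Fin n)) → Prop} (h : Recognizable R)
    (h' : Recognizable R') : Recognizable fun n _ κ => R n κ ∧ R' n κ := by
  obtain ⟨σ, hσ, M, hM⟩ := h
  obtain ⟨σ', hσ', M', hM'⟩ := h'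
  refine ⟨Set σ × Set σ', inferInstance, (M.toDFA.inter M'.toDFA).toNFA, fun n _ κ => ?_⟩
  rw [DFA.toNFA_correct, DFA.accepts_inter, NFA.toDFA_correct, NFA.toDFA_correct]
  exact and_congr (hM n κ) (hM' n κ)

/-- Projection: the automaton guesses the bit of the erased track `none` at each step, and the
guesses along a run form the set `A`. -/
theorem exists_set {R : ∀ (n : ℕ) [NeZero n], (Option V → Set (Fin n)) → Prop}
    (h : Recognizable R) :
    Recognizable fun n _ (κ : V → Set (Fin n)) => ∃ A, R n fun v => v.elim A κ := by
  obtain ⟨σ, hσ, M, hM⟩ := h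
  refine ⟨σ, hσ, ⟨fun s a => {t | ∃ b, t ∈ M.step s fun v => v.elim b a}, M.start, M.accept⟩,
    fun n _ κ => ?_⟩
  simp only [← hM, NFA.ofFn_mem_accepts]
  constructor
  · rintro ⟨ρ, h₀, h, hF⟩
    choose b hb using h
    refine ⟨{i | b i = true}, ρ, h₀, fun i => ?_, hF⟩
    have : wordOf (fun v : Option V => v.elim {i | b i = true} κ) i =
        fun v => v.elim (b i) (wordOf κ i) := by
      funext v
      cases v with
      | none => exact Bool.eq_iff_iff.2 (wordOf_eq_true _ _ _)
      | some v => rfl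
    exact this ▸ hb i
  · rintro ⟨A, ρ, h₀, h, hF⟩
    refine ⟨ρ, h₀, fun i => ⟨wordOf (fun v : Option V => v.elim A κ) i none, ?_⟩, hF⟩
    convert h i using 2
    funext v
    cases v <;> rfl

/-- Conditions on the first letter and on pairs of consecutive letters are recognizable. -/
theorem consecutive [Finite V] (I : (V → Bool) → Prop) (C : (V → Bool) → (V → Bool) → Prop) :
    Recognizable fun n _ (κ : V → Set (Fin n)) =>
      I (wordOf κ 0) ∧ ∀ i, C (wordOf κ i) (wordOf κ (wsSucc i)) := by
  -- A state is the predicted next letter, with `none` predicting the end of the word. At the end,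
  -- `t.getD a` compares the last letter with itself, as required by a successor that loops.
  refine ⟨Option (V → Bool), inferInstance,
    ⟨fun s a => {t | s = some a ∧ C a (t.getD a)}, {s | ∃ a, I a ∧ s = some a}, {none}⟩,
    fun n _ κ => ?_⟩
  obtain ⟨N, rfl⟩ : ∃ N, n = N + 1 := Nat.exists_eq_succ_of_ne_zero (NeZero.ne n)
  have hlast : wsSucc (Fin.last N) = Fin.last N := by
    ext; simp [wsSucc]
  have hcast : ∀ i : Fin N, wsSucc i.castSucc = i.succ := fun i => by
    ext
    simp only [wsSucc, Fin.val_castSucc, Fin.val_succ]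
    omega
  rw [NFA.ofFn_mem_accepts]
  constructor
  · rintro ⟨ρ, ⟨a, ha, h₀⟩, h, hF⟩
    have hρ : ∀ i : Fin (N + 1), ρ i.castSucc = some (wordOf κ i) := fun i => (h i).1
    have ha' : a = wordOf κ 0 := Option.some.inj (h₀.symm.trans (hρ 0))
    refine ⟨ha' ▸ ha, fun i => ?_⟩
    have hC := (h i).2
    induction i using Fin.lastCases with
    | last =>
      rw [Fin.succ_last, (hF : ρ _ = none)] at hC
      rw [hlast]
      exact hC
    | cast i =>
      rw [Fin.succ_castSucc, hρ] at hC
      rw [hcast]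
      exact hC
  · rintro ⟨h₀, h⟩
    refine ⟨Fin.snoc (fun i => some (wordOf κ i)) none, ⟨_, h₀, ?_⟩, fun i => ⟨?_, ?_⟩, ?_⟩
    · rw [← Fin.castSucc_zero, Fin.snoc_castSucc]
    · rw [Fin.snoc_castSucc]
    · have hC := h i
      induction i using Fin.lastCases with
      | last =>
        rw [Fin.succ_last, Fin.snoc_last]
        rwa [hlast] at hC
      | cast i =>
        rw [Fin.succ_castSucc, Fin.snoc_castSucc]
        rwa [hcast] at hC
    · rw [Fin.snoc_last]
      rfl

theorem subset [Finite V] (u v : V) :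
    Recognizable fun n _ (κ : V → Set (Fin n)) => κ u ⊆ κ v :=
  (consecutive (fun _ => True) fun a _ => a u = true → a v = true).congr fun n _ κ => by
    simp only [wordOf_eq_true, true_and]
    rfl

theorem eq_empty [Finite V] (u : V) :
    Recognizable fun n _ (κ : V → Set (Fin n)) => κ u = ∅ :=
  (consecutive (fun _ => True) fun a _ => ¬ a u = true).congr fun n _ κ => by
    simp only [wordOf_eq_true, true_and, Set.eq_empty_iff_forall_notMem]

/-- A singleton is a nonempty set without a nonempty proper subset, which uses only inclusion,
emptiness and the closure properties. -/
theorem singleton [Finite V] (v : V) :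
    Recognizable fun n _ (κ : V → Set (Fin n)) => ∃ a, κ v = {a} := by
  refine ((eq_empty v).not.and (((subset none (some v)).and
    ((eq_empty none).not.and (subset (some v) none).not)).exists_set.not)).congr fun n _ κ => ?_
  simp only [Option.elim_none, Option.elim_some]
  constructor
  · rintro ⟨hne, h⟩
    obtain ⟨a, ha⟩ := Set.nonempty_iff_ne_empty.2 hne
    refine ⟨a, (Set.Subset.antisymm ?_ (Set.singleton_subset_iff.2 ha))⟩
    by_contra hc
    exact h ⟨{a}, Set.singleton_subset_iff.2 ha, Set.singleton_ne_empty a, hc⟩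
  · rintro ⟨a, ha⟩
    rw [ha]
    refine ⟨Set.singleton_ne_empty a, ?_⟩
    rintro ⟨A, hA, hne, hc⟩
    rcases Set.subset_singleton_iff_eq.1 hA with rfl | rfl
    · exact hne rfl
    · exact hc subset_rfl

end Recognizable

/-! ### Recognizability by induction on formulae, and Büchi's theorem -/

namespace WForm

variable {P : Type}

/-- The models of a formula are recognizable when each symbol and each variable is read from some
track of the alphabet, a first-order variable from a track that holds a singleton. -/
def HasRecognizableModels {k m : ℕ} (φ : WForm P k m) : Prop :=
  ∀ (V : Type) [Finite V] (f : P → V) (g : Fin k → V) (h : Fin m → V),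
    ∃ R : ∀ (n : ℕ) [NeZero n], (V → Set (Fin n)) → Prop, Recognizable R ∧
      ∀ (n : ℕ) [NeZero n] (κ : V → Set (Fin n)) (ν : Fin k → Fin n), (∀ x, κ (g x) = {ν x}) →
        (R n κ ↔ φ.Sat (fun p => κ (f p)) ν fun X => κ (h X))

namespace HasRecognizableModels

variable {k m : ℕ}

theorem congr {φ ψ : WForm P k m} (h : φ.HasRecognizableModels)
    (hψ : ∀ (n : ℕ) [NeZero n] (ι : P → Set (Fin n)) (ν : Fin k → Fin n)
      (μ : Fin m → Set (Fin n)), φ.Sat ι ν μ ↔ ψ.Sat ι ν μ) : ψ.HasRecognizableModels := by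
  intro V _ f g e
  obtain ⟨R, hR, hφ⟩ := h V f g e
  exact ⟨R, hR, fun n _ κ ν hν => (hφ n κ ν hν).trans (hψ n _ _ _)⟩

theorem and {φ ψ : WForm P k m} (hφ : φ.HasRecognizableModels) (hψ : ψ.HasRecognizableModels) :
    (φ.and ψ).HasRecognizableModels := by
  intro V _ f g e
  obtain ⟨R, hR, hRφ⟩ := hφ V f g e
  obtain ⟨R', hR', hRψ⟩ := hψ V f g e
  exact ⟨_, hR.and hR', fun n _ κ ν hν => and_congr (hRφ n κ ν hν) (hRψ n κ ν hν)⟩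

/-- Plain complementation suffices, since nothing is required of words in which the track of a
first-order variable is not a singleton. -/
theorem not {φ : WForm P k m} (hφ : φ.HasRecognizableModels) :
    φ.not.HasRecognizableModels := by
  intro V _ f g e
  obtain ⟨R, hR, hRφ⟩ := hφ V f g e
  exact ⟨_, hR.not, fun n _ κ ν hν => not_congr (hRφ n κ ν hν)⟩

theorem ex {φ : WForm P (k + 1) m} (hφ : φ.HasRecognizableModels) :
    φ.ex.HasRecognizableModels := by
  intro V _ f g e
  obtain ⟨R, hR, hRφ⟩ := hφ (Option V) (fun p => some (f p))
    (Fin.cons none fun x => some (g x)) (fun X => some (e X))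
  -- A first-order quantifier is a set quantifier over a new track, restricted to singletons.
  refine ⟨_, ((Recognizable.singleton none).and hR).exists_set, fun n _ κ ν hν => ?_⟩
  have key : ∀ a : Fin n, _ ↔ _ := fun a =>
    hRφ n (fun v => v.elim {a} κ) (Fin.cons a ν) (Fin.cases rfl hν)
  constructor
  · rintro ⟨A, ⟨a, rfl⟩, h⟩
    exact ⟨a, (key a).1 h⟩
  · rintro ⟨a, h⟩
    exact ⟨{a}, ⟨a, rfl⟩, (key a).2 h⟩

theorem exS {φ : WForm P k (m + 1)} (hφ : φ.HasRecognizableModels) :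
    φ.exS.HasRecognizableModels := by
  intro V _ f g e
  obtain ⟨R, hR, hRφ⟩ := hφ (Option V) (fun p => some (f p))
    (fun x => some (g x)) (Fin.cons none fun X => some (e X))
  refine ⟨_, hR.exists_set, fun n _ κ ν hν => exists_congr fun A => ?_⟩
  refine (hRφ n (fun v => v.elim A κ) ν hν).trans (Eq.to_iff ?_)
  congr 1
  funext X
  induction X using Fin.cases <;> rfl

/-- Since variables are singleton tracks, this and the following atoms become conditions on the
first letter or on consecutive letters, inclusions among them. -/
theorem eq_zero_var (x : Fin k) :
    (eq WTerm.zero (WTerm.var x) : WForm P k m).HasRecognizableModels := by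
  intro V _ f g e
  refine ⟨_, Recognizable.consecutive (fun a => a (g x) = true) (fun _ _ => True),
    fun n _ κ ν hν => ?_⟩
  simp only [Automaton.wordOf_eq_true, hν, Set.mem_singleton_iff, Sat, WTerm.val_zero,
    WTerm.val_var, implies_true, and_true]

theorem eq_succ_var (x y : Fin k) :
    (eq (WTerm.var x).succ (WTerm.var y) : WForm P k m).HasRecognizableModels := by
  intro V _ f g e
  refine ⟨_, Recognizable.consecutive (fun _ => True) (fun a b => a (g x) = true → b (g y) = true),
    fun n _ κ ν hν => ?_⟩
  simp only [Automaton.wordOf_eq_true, hν, Set.mem_singleton_iff, Sat, WTerm.val_succ,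
    WTerm.val_var, true_and, forall_eq]

theorem eq_var_var (x y : Fin k) :
    (eq (WTerm.var x) (WTerm.var y) : WForm P k m).HasRecognizableModels := by
  intro V _ f g e
  refine ⟨_, Recognizable.subset (g x) (g y), fun n _ κ ν hν => ?_⟩
  simp only [hν, Set.singleton_subset_iff, Set.mem_singleton_iff, Sat, WTerm.val_var]

theorem pred_var (p : P) (x : Fin k) :
    (pred p (WTerm.var x) : WForm P k m).HasRecognizableModels := by
  intro V _ f g e
  refine ⟨_, Recognizable.subset (g x) (f p), fun n _ κ ν hν => ?_⟩
  simp only [hν, Set.singleton_subset_iff, Sat, WTerm.val_var]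

theorem mem_var (X : Fin m) (x : Fin k) :
    (mem X (WTerm.var x) : WForm P k m).HasRecognizableModels := by
  intro V _ f g e
  refine ⟨_, Recognizable.subset (g x) (e X), fun n _ κ ν hν => ?_⟩
  simp only [hν, Set.singleton_subset_iff, Sat, WTerm.val_var]

end HasRecognizableModels

end WForm

/-- The term over one more variable. -/
def WTerm.weaken {k : ℕ} (t : WTerm k) : WTerm (k + 1) := ⟨t.shift, t.base.map Fin.succ⟩

theorem WTerm.val_weaken {k n : ℕ} [NeZero n] (t : WTerm k) (a : Fin n) (ν : Fin k → Fin n) :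
    t.weaken.val (Fin.cons a ν) = t.val ν := by
  obtain ⟨i, _ | x⟩ := t <;> rfl

namespace WForm

variable {P : Type}

/-- The outermost successor is peeled off through an intermediate point `z` with `succ^i(b) = z` and
`succ(z) = x`. -/
theorem hasRecognizableModels_eq_var (i : ℕ) {k m : ℕ} (b : Option (Fin k)) (x : Fin k) :
    (eq ⟨i, b⟩ (WTerm.var x) : WForm P k m).HasRecognizableModels := by
  induction i generalizing k with
  | zero =>
    cases b with
    | none => exact .eq_zero_var x
    | some y => exact .eq_var_var y x
  | succ i ih =>
    refine ((ih (b.map Fin.succ) 0).and (.eq_succ_var 0 x.succ)).ex.congr fun n _ ι ν μ => ?_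
    have h₁ : ∀ a : Fin n, (⟨i, b.map Fin.succ⟩ : WTerm (k + 1)).val (Fin.cons a ν) =
      (⟨i, b⟩ : WTerm k).val ν := fun a => WTerm.val_weaken ⟨i, b⟩ a ν
    have h₂ : (⟨i + 1, b⟩ : WTerm k).val ν = wsSucc ((⟨i, b⟩ : WTerm k).val ν) :=
      WTerm.val_succ ν ⟨i, b⟩
    simp only [Sat, h₁, h₂, WTerm.val_succ, WTerm.val_var, Fin.cons_zero, Fin.cons_succ,
      exists_eq_left']

theorem hasRecognizableModels {k m : ℕ} (φ : WForm P k m) : φ.HasRecognizableModels := by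
  induction φ with
  | eq t u =>
    -- In each atom the terms are named by a fresh variable, which reduces it to the atoms on
    -- variables.
    refine ((hasRecognizableModels_eq_var _ _ 0).and
      (hasRecognizableModels_eq_var _ _ 0)).ex.congr
      (φ := ((eq t.weaken (WTerm.var 0)).and (eq u.weaken (WTerm.var 0))).ex) fun n _ ι ν μ => ?_
    simp only [Sat, WTerm.val_weaken, WTerm.val_var, Fin.cons_zero, exists_eq_left']
    exact eq_comm
  | pred p t =>
    refine ((hasRecognizableModels_eq_var _ _ 0).and (.pred_var p 0)).ex.congr
      (φ := ((eq t.weaken (WTerm.var 0)).and (pred p (WTerm.var 0))).ex) fun n _ ι ν μ => ?_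
    simp only [Sat, WTerm.val_weaken, WTerm.val_var, Fin.cons_zero, exists_eq_left']
  | mem X t =>
    refine ((hasRecognizableModels_eq_var _ _ 0).and (.mem_var X 0)).ex.congr
      (φ := ((eq t.weaken (WTerm.var 0)).and (mem X (WTerm.var 0))).ex) fun n _ ι ν μ => ?_
    simp only [Sat, WTerm.val_weaken, WTerm.val_var, Fin.cons_zero, exists_eq_left']
  | and φ ψ ihφ ihψ => exact ihφ.and ihψ
  | not φ ih => exact ih.not
  | ex φ ih => exact ih.ex
  | exS φ ih => exact ih.exS

/-- Büchi's theorem: every WS1S sentence over finitely many predicate symbols has an automaton. -/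
theorem exists_isAutomatonOf [Finite P] (φ : WForm P 0 0) :
    ∃ A : Automaton P, A.IsAutomatonOf φ := by
  classical
  have := Fintype.ofFinite P
  obtain ⟨R, ⟨σ, hσ, M, hM⟩, hR⟩ := φ.hasRecognizableModels P id Fin.elim0 Fin.elim0
  -- The states are numbered because an `Automaton` has states in `Fin q`.
  let e := Finite.equivFin σ
  refine ⟨⟨Nat.card σ, Finset.univ.filter fun i => e.symm i ∈ M.start,
    Finset.univ.filter fun i => e.symm i ∈ M.accept,
    Finset.univ.filter fun t => e.symm t.2.2 ∈ M.step (e.symm t.1) t.2.1⟩, fun n _ ι => ?_⟩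
  have h := (hM n ι).trans (hR n ι Fin.elim0 fun x => x.elim0)
  have h₀ : (fun X : Fin 0 => ι (Fin.elim0 X)) = Fin.elim0 := funext fun X => X.elim0
  rw [h₀] at h
  refine h.symm.trans ((NFA.ofFn_mem_accepts M _).trans ?_)
  simp only [Automaton.Accepts, Finset.mem_filter, Finset.mem_univ, true_and]
  constructor
  · rintro ⟨ρ, hρ⟩
    exact ⟨fun i => e (ρ i), by simpa using hρ⟩
  · rintro ⟨ρ, hρ⟩
    exact ⟨fun i => e.symm (ρ i), hρ⟩

end WForm

/-! ### Trap constraints and traps -/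

namespace System

variable (𝒮 : System) {n : ℕ}

/-- A port determines its component type by disjointness and then its transition by
`ComponentType.unique`. This makes the choices in `preAtom` and `postAtom` harmless. -/
theorem Step.unique {𝒮 : System} {p : 𝒮.Port} {s₁ s₁' s₂ s₂' : 𝒮.State} (h₁ : 𝒮.Step s₁ p s₁')
    (h₂ : 𝒮.Step s₂ p s₂') : s₁ = s₂ ∧ s₁' = s₂' := by
  obtain ⟨k, a, q, b, h, rfl, rfl, rfl⟩ := h₁
  obtain ⟨k', a', q', b', h', rfl, hp, rfl⟩ := h₂
  obtain ⟨rfl, hq⟩ := Sigma.mk.inj hp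
  obtain rfl := eq_of_heq hq
  have := (𝒮.comp k).unique _ h _ h' rfl
  simp_all

theorem sat_preAtom (ι : 𝒮.Pred → Set (Fin n)) {k : ℕ} (ν : Fin k → Fin n) (p : 𝒮.Port)
    (t : ITerm k) :
    (𝒮.preAtom p t).Sat ι ν ↔ ∃ s s', 𝒮.Step s p s' ∧ t.val ν ∈ ι (Sum.inr s) := by
  unfold preAtom
  split_ifs with h
  · obtain ⟨s', hs'⟩ := h.choose_spec
    refine ⟨fun hι => ⟨_, s', hs', hι⟩, ?_⟩
    rintro ⟨s, s'', hs, hι⟩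
    rw [(hs.unique hs').1] at hι
    exact hι
  · exact iff_of_false (ILForm.not_sat_bot ι ν) fun ⟨s, s', hs, _⟩ => h ⟨s, s', hs⟩

theorem sat_postAtom (ι : 𝒮.Pred → Set (Fin n)) {k : ℕ} (ν : Fin k → Fin n) (p : 𝒮.Port)
    (t : ITerm k) :
    (𝒮.postAtom p t).Sat ι ν ↔ ∃ s s', 𝒮.Step s p s' ∧ t.val ν ∈ ι (Sum.inr s') := by
  unfold postAtom
  split_ifs with h
  · obtain ⟨s, hs⟩ := h.choose_spec
    refine ⟨fun hι => ⟨s, _, hs, hι⟩, ?_⟩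
    rintro ⟨s', s'', hs', hι⟩
    rw [(hs'.unique hs).2] at hι
    exact hι
  · exact iff_of_false (ILForm.not_sat_bot ι ν) fun ⟨s, s', hs, _⟩ => h ⟨s', s, hs⟩

/-- Merges the individual and the broadcast ports of a disjunct; `R` is instantiated once with input
places and once with output places. -/
theorem exists_mem_described {d : Interaction 𝒮.Port} {ν : Fin d.ell → Fin n}
    (R : 𝒮.Port → Fin n → Prop) :
    (∃ p, ∃ i ∈ 𝒮.described d ν (Sum.inl p), R p i) ↔
      (∃ j, R (d.port j) (ν j)) ∨
        ∃ j i, (d.psi j).Sat (fun e => e.elim) (Fin.cons i ν) ∧ R (d.bport j) i := by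
  constructor
  · rintro ⟨p, i, (⟨j, rfl, rfl⟩ | ⟨j, rfl, h⟩), hR⟩
    · exact Or.inl ⟨j, hR⟩
    · exact Or.inr ⟨j, i, h, hR⟩
  · rintro (⟨j, hR⟩ | ⟨j, i, h, hR⟩)
    · exact ⟨_, _, Or.inl ⟨j, rfl, rfl⟩, hR⟩
    · exact ⟨_, _, Or.inr ⟨j, rfl, h⟩, hR⟩

theorem sat_disjunctTrapConstraint (d : Interaction 𝒮.Port) (ι : 𝒮.Pred → Set (Fin n)) :
    (𝒮.disjunctTrapConstraint d).Sat ι Fin.elim0 ↔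
      ∀ ν : Fin d.ell → Fin n, d.phi.Sat (fun e => e.elim) ν →
        (∃ p, ∃ i ∈ 𝒮.described d ν (Sum.inl p), ∃ s s', 𝒮.Step s p s' ∧ i ∈ ι (Sum.inr s)) →
        ∃ p, ∃ i ∈ 𝒮.described d ν (Sum.inl p), ∃ s s', 𝒮.Step s p s' ∧ i ∈ ι (Sum.inr s') := by
  simp only [disjunctTrapConstraint, ILForm.sat_alls, ILForm.sat_imp, ILForm.Sat, ILForm.sat_or,
    ILForm.sat_bigOr, ILForm.sat_lift, List.mem_map, List.mem_finRange, true_and,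
    exists_exists_eq_and, sat_preAtom, sat_postAtom, ITerm.val_var, Fin.cons_zero,
    exists_mem_described, and_imp]

theorem sat_trapConstraint (ι : 𝒮.Pred → Set (Fin n)) :
    𝒮.trapConstraint.Sat ι Fin.elim0 ↔
      ∀ d ∈ 𝒮.disjuncts, (𝒮.disjunctTrapConstraint d).Sat ι Fin.elim0 := by
  simp [trapConstraint, ILForm.sat_bigAnd]

/-- For fixed values of the variables, a disjunct only demands port instances, so the described
interaction is the least interpretation meeting the demand. -/
theorem sat_disjunctForm (d : Interaction 𝒮.Port) (ι : 𝒮.Pred → Set (Fin n)) :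
    (𝒮.disjunctForm d).Sat ι Fin.elim0 ↔
      ∃ ν : Fin d.ell → Fin n, d.phi.Sat (fun e => e.elim) ν ∧ 𝒮.described d ν ≤ ι := by
  simp only [disjunctForm, ILForm.sat_exs, ILForm.Sat, ILForm.sat_lift, ILForm.sat_bigAnd,
    List.mem_map, List.mem_finRange, true_and, forall_exists_index, forall_apply_eq_imp_iff,
    ILForm.sat_all, ILForm.sat_imp, ITerm.val_var, Fin.cons_zero]
  refine exists_congr fun ν => and_congr_right fun _ => ⟨?_, ?_⟩
  · rintro ⟨h₁, h₂⟩ (p | s) i hi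
    · rcases hi with ⟨j, rfl, rfl⟩ | ⟨j, rfl, h⟩
      · exact h₁ j
      · exact h₂ j i h
    · exact hi.elim
  · exact fun h => ⟨fun j => h (Sum.inl _) (Or.inl ⟨j, rfl, rfl⟩),
      fun j i hi => h (Sum.inl _) (Or.inr ⟨j, rfl, hi⟩)⟩

theorem sat_interactionForm (ι : 𝒮.Pred → Set (Fin n)) :
    𝒮.interactionForm.Sat ι Fin.elim0 ↔ ∃ d ∈ 𝒮.disjuncts, ∃ ν : Fin d.ell → Fin n,
      d.phi.Sat (fun e => e.elim) ν ∧ 𝒮.described d ν ≤ ι := by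
  simp [interactionForm, ILForm.sat_bigOr, sat_disjunctForm]

/-- Every minimal model of the interaction formula is an interaction described by a disjunct. -/
theorem exists_eq_described {ι : 𝒮.Pred → Set (Fin n)}
    (h : 𝒮.interactionForm.IsMinimalModel ι) : ∃ d ∈ 𝒮.disjuncts, ∃ ν : Fin d.ell → Fin n,
      d.phi.Sat (fun e => e.elim) ν ∧ 𝒮.described d ν = ι := by
  obtain ⟨d, hd, ν, hφ, hle⟩ := (𝒮.sat_interactionForm ι).1 h.1
  refine ⟨d, hd, ν, hφ, ?_⟩
  by_contra hne
  exact h.2 _ hle hne ((𝒮.sat_interactionForm _).2 ⟨d, hd, ν, hφ, le_rfl⟩)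

/-- The set of places described by the interpretation of the state symbols. -/
def places (ι : 𝒮.Pred → Set (Fin n)) : Set (𝒮.State × Fin n) := {x | x.2 ∈ ι (Sum.inr x.1)}

theorem isTrap_iff (W : Set (𝒮.State × Fin n)) :
    (𝒮.net n).IsTrap W ↔ ∀ ι : 𝒮.Pred → Set (Fin n), 𝒮.interactionForm.IsMinimalModel ι →
      (∃ p, ∃ i ∈ ι (Sum.inl p), ∃ s s', 𝒮.Step s p s' ∧ (s, i) ∈ W) →
      ∃ p, ∃ i ∈ ι (Sum.inl p), ∃ s s', 𝒮.Step s p s' ∧ (s', i) ∈ W := by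
  constructor
  · rintro h ι hι ⟨p, i, hi, s, s', hs, hW⟩
    obtain ⟨⟨t, j⟩, ht, u, q, hu, hj⟩ := @h ⟨ι, hι⟩ ⟨(s, i), hW, p, s', hs, hi⟩
    exact ⟨q, j, hj, u, t, hu, ht⟩
  · rintro h ⟨ι, hι⟩ ⟨⟨s, i⟩, hW, p, s', hs, hi⟩
    obtain ⟨q, j, hj, u, t, hu, ht⟩ := h ι hι ⟨p, i, hi, s, s', hs, hW⟩
    exact ⟨(t, j), ht, u, q, hu, hj⟩

/-- The transitions of the net are minimal models, hence described interactions, and the trap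
constraint covers all of these. -/
theorem isTrap_places_of_sat {ι : 𝒮.Pred → Set (Fin n)}
    (h : 𝒮.trapConstraint.Sat ι Fin.elim0) : (𝒮.net n).IsTrap (𝒮.places ι) := by
  rw [isTrap_iff]
  intro κ hκ hpre
  obtain ⟨d, hd, ν, hφ, rfl⟩ := 𝒮.exists_eq_described hκ
  exact (𝒮.sat_disjunctTrapConstraint d ι).1 ((𝒮.sat_trapConstraint ι).1 h d hd) ν hφ hpre

theorem sat_trapConstraint_of_isTrap (hΓ : 𝒮.Irredundant n) {ι : 𝒮.Pred → Set (Fin n)}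
    (h : (𝒮.net n).IsTrap (𝒮.places ι)) : 𝒮.trapConstraint.Sat ι Fin.elim0 := by
  rw [isTrap_iff] at h
  refine (𝒮.sat_trapConstraint ι).2 fun d hd => (𝒮.sat_disjunctTrapConstraint d ι).2 ?_
  rintro ν hφ ⟨p, i, hi, hpre⟩
  -- Irredundance places the port instance that touches the trap in a minimal model `κ` inside the
  -- interaction. The output place that the trap condition gives for `κ` also serves the
  -- interaction.
  obtain ⟨κ, hκ, hle, hiκ⟩ := hΓ d hd ν hφ p i hi
  obtain ⟨q, j, hj, hpost⟩ := h κ hκ ⟨p, i, hiκ, hpre⟩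
  exact ⟨q, j, hle _ hj, hpost⟩

theorem sat_initForm [NeZero n] (ι : 𝒮.Pred → Set (Fin n)) :
    𝒮.initForm.Sat ι Fin.elim0 Fin.elim0 ↔ ∃ x ∈ 𝒮.places ι, (𝒮.net n).m₀ x = 1 := by
  simp only [initForm, WForm.Sat, WForm.sat_bigOr, List.mem_map, List.mem_finRange, true_and,
    exists_exists_eq_and, WTerm.val_var, Fin.cons_zero]
  constructor
  · rintro ⟨i, k, h⟩
    exact ⟨(⟨k, _⟩, i), h, if_pos rfl⟩
  · rintro ⟨⟨⟨k, s⟩, i⟩, hx, hm⟩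
    obtain rfl : s = (𝒮.comp k).init := by
      by_contra hne
      have h0 : (𝒮.net n).m₀ (⟨k, s⟩, i) = 0 := if_neg hne
      omega
    exact ⟨i, k, hx⟩

theorem isIMT_places_of_sat [NeZero n] {ι : 𝒮.Pred → Set (Fin n)}
    (h : 𝒮.imtForm.Sat ι Fin.elim0 Fin.elim0) : (𝒮.net n).IsIMT (𝒮.places ι) :=
  ⟨𝒮.isTrap_places_of_sat ((ILForm.sat_Tr ι _).1 h.2), (𝒮.sat_initForm ι).1 h.1⟩

theorem sat_imtForm_of_isIMT [NeZero n] (hΓ : 𝒮.Irredundant n) {ι : 𝒮.Pred → Set (Fin n)}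
    (h : (𝒮.net n).IsIMT (𝒮.places ι)) : 𝒮.imtForm.Sat ι Fin.elim0 Fin.elim0 :=
  ⟨(𝒮.sat_initForm ι).2 h.2, (ILForm.sat_Tr ι _).2 (𝒮.sat_trapConstraint_of_isTrap hΓ h.1)⟩

/-! ### Both formulae as hitting conditions, and their comparison -/

theorem sat_trapInvariant (β : 𝒮.Pred × Fin n → Bool) :
    (𝒮.trapInvariant n).Sat β ↔
      ∀ W, (𝒮.net n).IsIMT W → ∃ x ∈ W, β (Sum.inr x.1, x.2) = true := by
  rw [trapInvariant, PForm.sat_map, MarkedPetriNet.sat_allTrap]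
  rfl

/-- The dual negates the positivation at the complement of `β`, so it says that no model is
contained in this complement. -/
theorem sat_booleanize_dual_positivation [NeZero n] {A : Automaton 𝒮.Pred}
    (hA : A.IsAutomatonOf 𝒮.imtForm) (β : 𝒮.Pred × Fin n → Bool) :
    (A.positivation.dual.booleanize n).Sat β ↔
      ∀ ι : 𝒮.Pred → Set (Fin n), 𝒮.imtForm.Sat ι Fin.elim0 Fin.elim0 →
        ∃ p, ∃ i ∈ ι p, β (p, i) = true := by
  rw [WForm.sat_booleanize, WForm.sat_dual, Automaton.sat_positivation]
  simp only [← hA n, not_exists, not_and]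
  refine forall_congr' fun ι => ⟨fun h hι => ?_, fun h hle hι => ?_⟩
  · by_contra hc
    push Not at hc
    exact h (fun p i hi => hc p i hi) hι
  · obtain ⟨p, i, hi, hβ⟩ := h hι
    exact hle p hi hβ

theorem entails_booleanize_dual_positivation {A : Automaton 𝒮.Pred}
    (hA : A.IsAutomatonOf 𝒮.imtForm) (n : ℕ) [NeZero n] :
    (𝒮.trapInvariant n).Entails (A.positivation.dual.booleanize n) := by
  intro β hβ
  rw [sat_trapInvariant] at hβ
  refine (𝒮.sat_booleanize_dual_positivation hA β).2 fun ι hι => ?_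
  obtain ⟨x, hx, h⟩ := hβ _ (𝒮.isIMT_places_of_sat hι)
  exact ⟨_, _, hx, h⟩

theorem equivalent_booleanize_dual_positivation {A : Automaton 𝒮.Pred}
    (hA : A.IsAutomatonOf 𝒮.imtForm) {n : ℕ} [NeZero n] (hΓ : 𝒮.Irredundant n) :
    (𝒮.trapInvariant n).Equivalent (A.positivation.dual.booleanize n) := by
  refine fun β => ⟨𝒮.entails_booleanize_dual_positivation hA n β, fun hβ => ?_⟩
  rw [sat_booleanize_dual_positivation 𝒮 hA] at hβ
  refine (𝒮.sat_trapInvariant β).2 fun W hW => ?_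
  -- The trap becomes a model with all port symbols empty, so `β` can meet it only at a state
  -- symbol, that is, at a place of `W`.
  obtain ⟨p, i, hi, h⟩ :=
    hβ (Sum.elim (fun _ => ∅) fun s => {i | (s, i) ∈ W}) (𝒮.sat_imtForm_of_isIMT hΓ hW)
  cases p with
  | inl p => exact hi.elim
  | inr s => exact ⟨(s, i), hi, h⟩

end System

end TrapInv

theorem mainTheorem1 (𝒮 : TrapInv.System) :
    (∃ A : TrapInv.Automaton 𝒮.Pred, A.IsAutomatonOf 𝒮.imtForm) ∧
    ∀ A : TrapInv.Automaton 𝒮.Pred, A.IsAutomatonOf 𝒮.imtForm →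
      ∀ (n : ℕ) [NeZero n],
        (𝒮.trapInvariant n).Entails (A.positivation.dual.booleanize n) ∧
        (𝒮.Irredundant n →
          (𝒮.trapInvariant n).Equivalent (A.positivation.dual.booleanize n)) := by
  have : Finite 𝒮.Pred := inferInstance
  exact ⟨𝒮.imtForm.exists_isAutomatonOf, fun A hA n _ =>
    ⟨𝒮.entails_booleanize_dual_positivation hA n, 𝒮.equivalent_booleanize_dual_positivation hA⟩⟩
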